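/- Let $p$ be a prime, let $\overline{\mathbb Q}_p$ be an algebraic closure of $\mathbb Q_p$, and let $\Pi_\natural\subset\Pi$ be an inclusion of finitely generated abelian groups with induced map $\pi_\natural\to\pi$ (an inclusion) of profinite completions. For a profinite abelian group $G$ let $G^{(p)}$ be its pro-$p$ completion, a $\mathbb Z_p$-module, and put $G^{(p)}_{\mathbb Q_p}=G^{(p)}\otimes_{\mathbb Z_p}\mathbb Q_p$. Let $\sigma\colon\pi\to\pi$ be a continuous automorphism, and let $\alpha\in\mathbb Z_p^\times$ be an element that is not a root of unity. Assume that the $\mathbb Q_p$-linear map which $\sigma$ induces on $\pi^{(p)}_{\mathbb Q_p}$ is semisimple, stabilizes $\pi^{(p)}_{\natural,\mathbb Q_p}$, is multiplication by $\alpha^{-2}$ on $\pi^{(p)}_{\natural,\mathbb Q_p}$, and induces multiplication by $\alpha^{-1}$ on $(\pi/\pi_\natural)^{(p)}_{\mathbb Q_p}$. Let $\mathrm{Char}^\Pi=\operatorname{Spec}\overline{\mathbb Q}_p[\Pi]$, whose $\overline{\mathbb Q}_p$-points are the characters $\Pi\to\overline{\mathbb Q}_p^\times$. Let $\mathrm{Hom}_{\mathrm{cont}}(\pi,\overline{\mathbb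 Q}_p^\times)$ be the union of the groups $\mathrm{Hom}_{\mathrm{cont}}(\pi,E^\times)$ over all finite extensions $E$ of $\mathbb Q_p$ in $\overline{\mathbb Q}_p$, on which $\sigma$ acts by $\chi\mapsto\chi\circ\sigma$, and let $$\varphi\colon \mathrm{Hom}_{\mathrm{cont}}(\pi,\overline{\mathbb Q}_p^\times)\to \mathrm{Char}^\Pi$$ send $\chi$ to the closed point given by the composite $\Pi\to\pi\xrightarrow{\chi}\overline{\mathbb Q}_p^\times$. A subtorus of $\mathrm{Char}^\Pi$ is a closed subset of the form $\operatorname{Spec}\overline{\mathbb Q}_p[\Pi']$ for a torsion-free quotient $\Pi'$ of $\Pi$. Let $S\subset\mathrm{Char}^\Pi$ be a Zariski closed subset such that $\varphi^{-1}(S)$ is stable under $\sigma$, i.e. $\chi\circ\sigma\in\varphi^{-1}(S)$ for all $\chi\in\varphi^{-1}(S)$. Then every irreducible component $S'$ of $S$ with $\varphi^{-1}(S')\neq\emptyset$ is the translate $\chi\cdot T$ of a subtorus $T$ of $\mathrm{Char}^\Pi$ by a torsion character $\chi\colon\Pi\to\overline{\mathbb Q}_p^\times$ (a character of finite order). -/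

import Mathlib

open scoped TensorProduct

universe u

noncomputable section

/-! ### Profinite completion of an abelian group -/

/-- The profinite completion of the (multiplicatively written) abelian group `Γ`: the limit of
its finite quotients. -/
def ProfComp (Γ : Type u) [CommGroup Γ] : Type u :=
  ProfiniteGrp.ProfiniteCompletion.completion (GrpCat.of Γ)

namespace ProfComp

variable (Γ : Type u) [CommGroup Γ]

instance : Group (ProfComp Γ) :=
  inferInstanceAs (Group (ProfiniteGrp.ProfiniteCompletion.completion (GrpCat.of Γ)))

instance : CommGroup (ProfComp Γ) :=
  { (inferInstance : Group (ProfComp Γ)) with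
    mul_comm := fun a b => by
      apply Subtype.ext
      funext H
      obtain ⟨x, hx⟩ := QuotientGroup.mk_surjective (a.1 H)
      obtain ⟨y, hy⟩ := QuotientGroup.mk_surjective (b.1 H)
      change a.1 H * b.1 H = b.1 H * a.1 H
      rw [← hx, ← hy]
      exact congrArg (QuotientGroup.mk (s := H.toSubgroup)) (mul_comm (G := Γ) x y) }

instance : TopologicalSpace (ProfComp Γ) :=
  inferInstanceAs (TopologicalSpace (ProfiniteGrp.ProfiniteCompletion.completion (GrpCat.of Γ)))

instance : IsTopologicalGroup (ProfComp Γ) :=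
  inferInstanceAs (IsTopologicalGroup (ProfiniteGrp.ProfiniteCompletion.completion (GrpCat.of Γ)))

/-- The canonical homomorphism from `Γ` to its profinite completion. -/
def of : Γ →* ProfComp Γ := (ProfiniteGrp.ProfiniteCompletion.eta (GrpCat.of Γ)).hom

variable {Γ}

/-- Functoriality of the profinite completion. -/
def map {Γ' : Type u} [CommGroup Γ'] (f : Γ' →* Γ) : ProfComp Γ' →ₜ* ProfComp Γ :=
  (ProfiniteGrp.profiniteCompletion.map (GrpCat.ofHom f)).hom

end ProfComp

/-! ### Pro-`p` completion and its rationalisation -/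

section ProP

variable (p : ℕ)

/-- Open subgroups of `p`-power index. -/
structure OpenPSubgroup (G : Type*) [CommGroup G] [TopologicalSpace G] where
  /-- the underlying subgroup -/
  toSubgroup : Subgroup G
  isOpen : IsOpen (toSubgroup : Set G)
  exists_index_eq : ∃ k : ℕ, toSubgroup.index = p ^ k

variable {p}

namespace OpenPSubgroup

variable {G H : Type*} [CommGroup G] [TopologicalSpace G] [CommGroup H] [TopologicalSpace H]

/-- The finite quotient `G / U`, written additively. -/
abbrev Quot (U : OpenPSubgroup p G) : Type _ := Additive (G ⧸ U.toSubgroup)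

/-- The exponent `k` with `[G : U] = p ^ k`. -/
def exponent (U : OpenPSubgroup p G) : ℕ := U.exists_index_eq.choose

lemma index_eq (U : OpenPSubgroup p G) : U.toSubgroup.index = p ^ U.exponent := U.exists_index_eq.choose_spec

lemma pow_smul_eq_zero (U : OpenPSubgroup p G) (x : U.Quot) : (p ^ U.exponent) • x = 0 := by
  have h : (x.toMul) ^ (p ^ U.exponent) = 1 := by
    rw [← U.index_eq, Subgroup.index]
    exact pow_card_eq_one'
  exact congrArg Additive.ofMul h

variable [Fact p.Prime]

/-- `G / U` is killed by `p ^ k`, so it is a module over `ℤ_p` through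
`ℤ_p → ℤ / p ^ k`. This is the unique `ℤ_p`-module structure on this finite group. -/
instance (U : OpenPSubgroup p G) : Module ℤ_[p] U.Quot :=
  letI : Module (ZMod (p ^ U.exponent)) U.Quot := AddCommGroup.zmodModule U.pow_smul_eq_zero
  Module.compHom _ (PadicInt.toZModPow (p := p) U.exponent)

lemma smul_eq (U : OpenPSubgroup p G) (z : ℤ_[p]) (x : U.Quot) (m : ℕ)
    (hm : PadicInt.toZModPow U.exponent z = (m : ZMod (p ^ U.exponent))) : z • x = m • x := by
  let _ : Module (ZMod (p ^ U.exponent)) U.Quot := AddCommGroup.zmodModule U.pow_smul_eq_zero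
  change PadicInt.toZModPow U.exponent z • x = m • x
  rw [hm, Nat.cast_smul_eq_nsmul]

/-- Any additive map between two such quotients is `ℤ_p`-linear. -/
lemma map_smul_of_add (U : OpenPSubgroup p G) (V : OpenPSubgroup p H) (f : U.Quot →+ V.Quot)
    (z : ℤ_[p]) (x : U.Quot) : f (z • x) = z • f x := by
  set n := max U.exponent V.exponent with hn
  have key : ∀ k ≤ n, PadicInt.toZModPow k z = ((z.appr n : ℕ) : ZMod (p ^ k)) := by
    intro k hk
    rw [← PadicInt.zmod_cast_comp_toZModPow k n hk]
    have h : PadicInt.toZModPow n z = ((z.appr n : ℕ) : ZMod (p ^ n)) := rfl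
    rw [RingHom.comp_apply, h, map_natCast]
  rw [smul_eq U z x _ (key _ (le_max_left _ _)), smul_eq V z _ _ (key _ (le_max_right _ _)),
    map_nsmul]

/-- The projection `G / U → G / V` for `U ≤ V`. -/
def proj {U V : OpenPSubgroup p G} (h : U.toSubgroup ≤ V.toSubgroup) : U.Quot →+ V.Quot :=
  MonoidHom.toAdditive (QuotientGroup.map U.toSubgroup V.toSubgroup (MonoidHom.id G) h)

/-- The preimage of an open subgroup of `p`-power index under a continuous homomorphism. -/
def comap (f : G →ₜ* H) (V : OpenPSubgroup p H) : OpenPSubgroup p G :=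
  ⟨V.toSubgroup.comap (f : G →* H), V.isOpen.preimage f.continuous_toFun, by
    have h : (V.toSubgroup.comap (f : G →* H)).index ∣ p ^ V.exponent := by
      rw [Subgroup.index_comap, ← V.index_eq]
      exact Subgroup.relIndex_dvd_index_of_normal _ _
    obtain ⟨k, -, hk⟩ := (Nat.dvd_prime_pow Fact.out).1 h
    exact ⟨k, hk⟩⟩

/-- The map `G / f⁻¹(V) → H / V` induced by `f`. -/
def comapMap (f : G →ₜ* H) (V : OpenPSubgroup p H) : (V.comap f).Quot →+ V.Quot :=
  MonoidHom.toAdditive (QuotientGroup.map (V.comap f).toSubgroup V.toSubgroup (f : G →* H) le_rfl)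

end OpenPSubgroup

variable (p) [Fact p.Prime]

/-- The pro-`p` completion of a (profinite) abelian group `G`: the limit of the quotients `G / U`
over all open subgroups `U` of `p`-power index, as a `ℤ_p`-module. -/
def ProP (G : Type*) [CommGroup G] [TopologicalSpace G] :
    Submodule ℤ_[p] (∀ U : OpenPSubgroup p G, U.Quot) where
  carrier := {x | ∀ (U V : OpenPSubgroup p G) (h : U.toSubgroup ≤ V.toSubgroup), OpenPSubgroup.proj h (x U) = x V}
  zero_mem' := fun U V h => map_zero _
  add_mem' := fun {x y} hx hy U V h => by
    rw [Pi.add_apply, map_add, hx U V h, hy U V h, Pi.add_apply]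
  smul_mem' := fun z x hx U V h => by
    rw [Pi.smul_apply, OpenPSubgroup.map_smul_of_add, hx U V h, Pi.smul_apply]

variable {G H : Type*} [CommGroup G] [TopologicalSpace G] [CommGroup H] [TopologicalSpace H]

/-- Functoriality of the pro-`p` completion. -/
def ProP.map (f : G →ₜ* H) : ProP p G →ₗ[ℤ_[p]] ProP p H where
  toFun x := ⟨fun V => V.comapMap f (x.1 (V.comap f)), fun U V h => by
    have hx := x.2 (U.comap f) (V.comap f) (Subgroup.comap_mono h)
    obtain ⟨g, hg⟩ := QuotientGroup.mk_surjective (Additive.toMul (x.1 (U.comap f)))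
    have hg' : x.1 (U.comap f) = Additive.ofMul (QuotientGroup.mk g) :=
      congrArg Additive.ofMul hg.symm
    change OpenPSubgroup.proj h (U.comapMap f (x.1 (U.comap f))) = V.comapMap f (x.1 (V.comap f))
    rw [← hx, hg']
    rfl⟩
  map_add' x y := Subtype.ext (funext fun V => map_add (V.comapMap f) _ _)
  map_smul' z x := Subtype.ext (funext fun V =>
    OpenPSubgroup.map_smul_of_add (V.comap f) V (V.comapMap f) z _)

variable (G) in
/-- The `ℚ_p`-vector space `G^{(p)} ⊗_{ℤ_p} ℚ_p`. -/
abbrev RatProP : Type _ := ℚ_[p] ⊗[ℤ_[p]] ProP p G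

/-- Functoriality of `G ↦ G^{(p)} ⊗_{ℤ_p} ℚ_p`. -/
def RatProP.map (f : G →ₜ* H) : RatProP p G →ₗ[ℚ_[p]] RatProP p H :=
  (ProP.map p f).baseChange ℚ_[p]

end ProP

/-- The quotient homomorphism `G → G / N`, where `G / N` has the quotient topology. -/
def quotientHom {G : Type*} [CommGroup G] [TopologicalSpace G] (N : Subgroup G) : G →ₜ* G ⧸ N where
  toMonoidHom := QuotientGroup.mk' N
  continuous_toFun := continuous_quot_mk

/-! ### Character varieties -/

section CharVariety

variable (K : Type*) [Field K] (Γ : Type*) [CommGroup Γ]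

/-- (The topological space underlying) the character variety `Spec K[Γ]`. -/
abbrev CharVar : Type _ := PrimeSpectrum (MonoidAlgebra K Γ)

variable {K Γ}

/-- The closed point of the character variety given by a character `χ : Γ → Kˣ`, that is, the
kernel of the `K`-algebra homomorphism `K[Γ] → K` extending `χ`. -/
def CharVar.point (χ : Γ →* Kˣ) : CharVar K Γ :=
  ⟨RingHom.ker (MonoidAlgebra.lift K K Γ ((Units.coeHom K).comp χ)), RingHom.ker_isPrime _⟩

/-- The `K`-algebra endomorphism `g ↦ χ(g) g` of `K[Γ]`. -/
def CharVar.twist (χ : Γ →* Kˣ) : MonoidAlgebra K Γ →ₐ[K] MonoidAlgebra K Γ :=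
  MonoidAlgebra.lift K (MonoidAlgebra K Γ) Γ
    { toFun := fun g => MonoidAlgebra.single g (χ g : K)
      map_one' := by simp [MonoidAlgebra.one_def]
      map_mul' := fun g h => by simp [MonoidAlgebra.single_mul_single] }

/-- Translation by the character `χ` on the character variety; on characters it is `ψ ↦ χ ψ`. -/
def CharVar.translate (χ : Γ →* Kˣ) : CharVar K Γ → CharVar K Γ :=
  PrimeSpectrum.comap (CharVar.twist χ).toRingHom

/-- The closed subset `Spec K[Γ/N]` of `Spec K[Γ]`. -/
def CharVar.ofQuotient (K : Type*) [Field K] (N : Subgroup Γ) : Set (CharVar K Γ) :=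
  Set.range (PrimeSpectrum.comap (MonoidAlgebra.mapDomainRingHom K (QuotientGroup.mk' N)))

/-- A subtorus of the character variety: `Spec K[Γ/N]` with `Γ/N` torsion free. -/
def CharVar.IsSubtorus (T : Set (CharVar K Γ)) : Prop :=
  ∃ N : Subgroup Γ, IsMulTorsionFree (Γ ⧸ N) ∧ T = CharVar.ofQuotient K N

end CharVariety

/-! ### Continuous `p`-adic characters -/

section ContChar

variable (p : ℕ) [Fact p.Prime]

/-- `Hom_cont(G, Q̄_pˣ)`, by definition the union of the groups of continuous homomorphisms to
`Eˣ` over all finite extensions `E` of `ℚ_p` inside `Q̄_p`. -/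
def ContChar (G : Type*) [CommGroup G] [TopologicalSpace G] : Type _ :=
  {χ : G →ₜ* (PadicAlgCl p)ˣ // ∃ E : IntermediateField ℚ_[p] (PadicAlgCl p),
    FiniteDimensional ℚ_[p] E ∧ ∀ g, ((χ g : (PadicAlgCl p)ˣ) : PadicAlgCl p) ∈ E}

variable {p}

/-- Precomposition of a continuous character with a continuous homomorphism. -/
def ContChar.comp {G H : Type*} [CommGroup G] [TopologicalSpace G] [CommGroup H]
    [TopologicalSpace H] (χ : ContChar p H) (f : G →ₜ* H) : ContChar p G :=
  ⟨χ.1.comp f, by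
    obtain ⟨E, hE, h⟩ := χ.2
    exact ⟨E, hE, fun g => h (f g)⟩⟩

/-- The map `φ` sending a continuous character of the profinite completion of `Γ` to the closed
point of the character variety of `Γ` given by its restriction to `Γ`. -/
def ContChar.phi {Γ : Type u} [CommGroup Γ] (χ : ContChar p (ProfComp Γ)) :
    CharVar (PadicAlgCl p) Γ :=
  CharVar.point ((χ.1 : ProfComp Γ →* (PadicAlgCl p)ˣ).comp (ProfComp.of Γ))

end ContChar

end

/-!
Write `K` for `PadicAlgCl p`. A continuous character `χ` of the profinite completion has a logarithm
`f`, a continuous homomorphism to a finite extension `E` of `ℚ_p` (`exists_logarithm`). The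
hypotheses on `σ` say that `f ∘ σ ^ n = α⁻ⁿ • c + α⁻²ⁿ • d` with `f = c + d`
(`exists_eigen_decomposition`). Modulo the open subgroup on which `χ = exp ∘ f`, the automorphism
`σ` has finite order `N`; hence, with `s = α ^ (-N n) - 1`,
`χ (σ ^ (N n) γ) = χ γ * exp (s * c γ + ((1 + s)² - 1) * d γ)`.

If the orbit of `χ` lies in `S` and `∑ a_γ γ` is one of the equations of `S`, then
`∑ a_γ χ γ exp (s * c γ + ((1 + s)² - 1) * d γ)` is analytic in `s` and has zeros accumulating at
`0`, because `α` is not a root of unity. So it vanishes identically near `0`, and as exponentials of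
distinct quadratic polynomials are linearly independent, the sums of `a_γ χ γ` over the classes
modulo `N₀ = ker c ∩ ker d` are zero (`sum_eq_zero_of_frequently_expSum_eq_zero`). This means that
the coset of `χ` under the torus `Spec K[Γ/N₀]` lies in `S`. On `N₀` the logarithm of `χ` is zero, so
`χ` has finite order there, and the coset contains a torsion character. Thus every integral point of
`S` lies on a torsion coset contained in `S` (`exists_subgroup_of_orbit`).

To pass from points to the component `S'`, two finiteness facts are used. The condition that a coset
lies in `S` depends only on how `N₀` partitions the finite set of exponents occurring in the equations
of `S`, so only finitely many subgroups are needed (`LiesOnTorsionCoset.exists_quotientSaturation`).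
And the points of `S'` in a `p`-adic neighbourhood of a given point are Zariski dense
(`exists_point_near_ne_zero`, by Noether normalization and the continuity of roots). Hence for one
subgroup `N` the nearby points whose `Spec K[Γ/N]`-coset is a torsion coset in `S` are already dense
in `S'`. Restricted to `N`, any two of them differ by a torsion character close to `1`, so they agree
(`eq_one_of_mem_unitBall`). Therefore `S'` is contained in a single torsion coset, which lies in `S`,
and equals it because `S'` is a component.
-/

noncomputable section

open Filter Topology NormedSpace

/-! ### The p-adic exponential -/

section Exponential

variable {p : ℕ} [Fact p.Prime] {E : Type*} [NontriviallyNormedField E] [NormedAlgebra ℚ_[p] E]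

lemma norm_natCast_eq_padic (n : ℕ) : ‖(n : E)‖ = ‖(n : ℚ_[p])‖ := by
  rw [← map_natCast (algebraMap ℚ_[p] E), norm_algebraMap']

variable (p) in
lemma norm_inv_factorial_le (n : ℕ) : ‖((n.factorial : ℕ) : E)⁻¹‖ ≤ (p : ℝ) ^ n := by
  have hp : (1 : ℝ) ≤ p := by exact_mod_cast (Fact.out : p.Prime).one_le
  rw [norm_inv, norm_natCast_eq_padic (p := p), Padic.norm_eq_zpow_neg_valuation
    (by exact_mod_cast n.factorial_ne_zero), Padic.valuation_natCast, zpow_neg, inv_inv,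
    zpow_natCast]
  refine pow_le_pow_right₀ hp ?_
  have h := sub_one_mul_padicValNat_factorial (p := p) n
  have h2 : 1 ≤ p - 1 := Nat.le_sub_one_of_lt (Fact.out : p.Prime).one_lt
  calc padicValNat p n.factorial ≤ (p - 1) * padicValNat p n.factorial := Nat.le_mul_of_pos_left _ h2
    _ = n - (p.digits n).sum := h
    _ ≤ n := Nat.sub_le _ _

variable (p E) in
/-- Since `v_p(n!) ≤ n`, the `p`-adic exponential series converges for `‖x‖ < 1 / p`. -/
lemma le_radius_expSeries : ENNReal.ofReal (1 / p) ≤ (expSeries E E).radius := by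
  refine FormalMultilinearSeries.le_radius_of_bound _ 1 (r := (1 / p : ℝ).toNNReal) fun n => ?_
  have hp : (0 : ℝ) < p := by exact_mod_cast (Fact.out : p.Prime).pos
  rw [Real.coe_toNNReal _ (by positivity)]
  have : ‖expSeries E E n‖ ≤ (p : ℝ) ^ n := by
    rw [expSeries, norm_smul]
    simpa using norm_inv_factorial_le p (E := E) n
  calc ‖expSeries E E n‖ * (1 / p : ℝ) ^ n ≤ (p : ℝ) ^ n * (1 / p : ℝ) ^ n := by gcongr
    _ = 1 := by rw [← mul_pow, mul_one_div_cancel hp.ne', one_pow]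

lemma mem_eball_radius {x : E} (hx : ‖x‖ < 1 / p) :
    x ∈ Metric.eball (0 : E) (expSeries E E).radius := by
  rw [Metric.mem_eball, edist_zero_right, ← ofReal_norm]
  exact ((ENNReal.ofReal_lt_ofReal_iff (lt_of_le_of_lt (norm_nonneg _) hx)).2 hx).trans_le
    (le_radius_expSeries p E)

lemma charZero_of_padic (p : ℕ) [Fact p.Prime] (E : Type*) [NontriviallyNormedField E]
    [NormedAlgebra ℚ_[p] E] : CharZero E :=
  charZero_of_injective_algebraMap (R := ℚ_[p]) (algebraMap ℚ_[p] E).injective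

variable [CompleteSpace E]

lemma padic_exp_add {x y : E} (hx : ‖x‖ < 1 / p) (hy : ‖y‖ < 1 / p) :
    exp (x + y) = exp x * exp y := by
  have := charZero_of_padic p E
  exact exp_add_of_commute_of_mem_ball (𝕂 := E) (Commute.all _ _) (mem_eball_radius hx)
    (mem_eball_radius hy)

lemma padic_exp_ne_zero {x : E} (hx : ‖x‖ < 1 / p) : exp x ≠ 0 := by
  have := charZero_of_padic p E
  exact (isUnit_exp_of_mem_ball (𝕂 := E) (mem_eball_radius hx)).ne_zero

lemma padic_exp_hasDerivAt {x : E} (hx : ‖x‖ < 1 / p) : HasDerivAt exp (exp x) x := by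
  have := charZero_of_padic p E
  exact hasDerivAt_exp_of_mem_ball (mem_eball_radius hx)

lemma padic_exp_analyticAt {x : E} (hx : ‖x‖ < 1 / p) : AnalyticAt E (exp : E → E) x := by
  have := charZero_of_padic p E
  exact analyticAt_exp_of_mem_ball x (mem_eball_radius hx)

variable (p E) in
/-- Near `0` the exponential is a homeomorphism onto a neighbourhood of `1`. -/
lemma exists_exp_injOn_ball : ∃ r : ℝ, 0 < r ∧ r ≤ 1 / p ∧ Set.InjOn exp (Metric.ball (0 : E) r) ∧
    ∀ r' : ℝ, 0 < r' → exp '' Metric.ball (0 : E) r' ∈ 𝓝 (1 : E) := by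
  have := charZero_of_padic p E
  have hp : (0 : ℝ) < 1 / p := one_div_pos.2 (by exact_mod_cast (Fact.out : p.Prime).pos)
  have h : HasStrictDerivAt exp (1 : E) 0 := hasStrictDerivAt_exp_zero_of_radius_pos
    (lt_of_lt_of_le (ENNReal.ofReal_pos.2 hp) (le_radius_expSeries p E))
  have hmap : map exp (𝓝 (0 : E)) = 𝓝 1 := by
    rw [h.map_nhds_eq one_ne_zero, exp_zero]
  have h' := h.hasStrictFDerivAt_equiv one_ne_zero
  obtain ⟨r, hr, hb⟩ := Metric.mem_nhds_iff.1
    ((h'.toOpenPartialHomeomorph exp).open_source.mem_nhds h'.mem_toOpenPartialHomeomorph_source)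
  refine ⟨min r (1 / p), lt_min hr hp, min_le_right _ _, ?_, fun r' hr' => ?_⟩
  · exact (h'.toOpenPartialHomeomorph exp).injOn.mono
      ((Metric.ball_subset_ball (min_le_left _ _)).trans hb)
  · rw [← hmap]
    exact image_mem_map (Metric.ball_mem_nhds _ hr')

end Exponential

/-! ### Linear independence of exponentials of polynomials -/

section LinearIndependence

open Polynomial

variable {E K : Type*} [NontriviallyNormedField E] [NormedField K] [NormedAlgebra E K]

lemma Polynomial.hasDerivAt_eval_algebraMap (P : K[X]) (s : E) :
    HasDerivAt (fun s : E => P.eval (algebraMap E K s)) (P.derivative.eval (algebraMap E K s)) s := by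
  have hid : HasDerivAt (fun s : E => algebraMap E K s) 1 s := by
    have h := (algebraMapCLM E K).hasDerivAt (x := s)
    rwa [show algebraMapCLM E K 1 = 1 from map_one (algebraMap E K)] at h
  induction P using Polynomial.induction_on' with
  | add P Q hP hQ => simpa using! hP.fun_add hQ
  | monomial n a =>
    simpa [derivative_monomial, mul_assoc] using (hid.fun_pow n).const_mul a

/-- Solutions `y i` near `0` of the equations `y' = ℓ i * y`, with pairwise distinct polynomials
`ℓ i`, are linearly independent over the polynomials. -/
theorem eq_zero_of_sum_polynomial_mul_eq_zero {ι : Type*} (y : ι → E → K) (ℓ : ι → K[X])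
    (hℓ : Function.Injective ℓ)
    (hy : ∀ i, ∀ᶠ s in 𝓝 (0 : E), HasDerivAt (y i) ((ℓ i).eval (algebraMap E K s) * y i s) s)
    (hy0 : ∀ i, ∀ᶠ s in 𝓝 (0 : E), y i s ≠ 0) (I : Finset ι) :
    ∀ P : ι → K[X], (∀ᶠ s in 𝓝 (0 : E), ∑ i ∈ I, (P i).eval (algebraMap E K s) * y i s = 0) →
      ∀ i ∈ I, P i = 0 := by
  classical
  induction I using Finset.induction_on with
  | empty => simp
  | insert j I hj ih =>
    intro P hP
    -- Differentiate the relation and eliminate `y j` between the two relations.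
    have hI : ∀ i ∈ I, P j * (P i).derivative + P j * P i * ℓ i
        - P i * (P j).derivative - P i * P j * ℓ j = 0 := by
      refine ih _ ?_
      have hall : ∀ᶠ s in 𝓝 (0 : E), ∀ i ∈ insert j I,
          HasDerivAt (y i) ((ℓ i).eval (algebraMap E K s) * y i s) s :=
        (Filter.eventually_all_finset _).2 fun i _ => hy i
      filter_upwards [hP, hP.eventually_nhds, hall] with s h0 hs hd
      have h1 : HasDerivAt (fun s => ∑ i ∈ insert j I, (P i).eval (algebraMap E K s) * y i s)
          (∑ i ∈ insert j I, ((P i).derivative.eval (algebraMap E K s) * y i s +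
            (P i).eval (algebraMap E K s) * ((ℓ i).eval (algebraMap E K s) * y i s))) s :=
        HasDerivAt.fun_sum fun i hi => ((P i).hasDerivAt_eval_algebraMap s).mul (hd i hi)
      have h2 := h1.unique ((hasDerivAt_const s (0 : K)).congr_of_eventuallyEq hs)
      rw [Finset.sum_insert hj] at h0 h2
      have h3 : ∑ i ∈ I, (P j * (P i).derivative + P j * P i * ℓ i
          - P i * (P j).derivative - P i * P j * ℓ j).eval (algebraMap E K s) * y i s =
          (P j).eval (algebraMap E K s) *
            ∑ i ∈ I, ((P i).derivative.eval (algebraMap E K s) * y i s +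
            (P i).eval (algebraMap E K s) * ((ℓ i).eval (algebraMap E K s) * y i s)) -
          ((P j).derivative.eval (algebraMap E K s) +
            (P j).eval (algebraMap E K s) * (ℓ j).eval (algebraMap E K s)) *
            ∑ i ∈ I, (P i).eval (algebraMap E K s) * y i s := by
        rw [Finset.mul_sum, Finset.mul_sum, ← Finset.sum_sub_distrib]
        refine Finset.sum_congr rfl fun i _ => ?_
        simp only [eval_sub, eval_add, eval_mul]
        ring
      rw [h3]
      linear_combination (P j).eval (algebraMap E K s) * h2 -
          ((P j).derivative.eval (algebraMap E K s) +
            (P j).eval (algebraMap E K s) * (ℓ j).eval (algebraMap E K s)) * h0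
    by_cases hPj : P j = 0
    · have := ih P (by
        filter_upwards [hP] with s hs
        simpa [Finset.sum_insert hj, hPj] using hs)
      simpa [hPj] using this
    · exfalso
      have hPi : ∀ i ∈ I, P i = 0 := by
        intro i hi
        by_contra hne
        have hij : ℓ j - ℓ i ≠ 0 := sub_ne_zero.2 fun h => hj (hℓ h ▸ hi)
        have heq : P j * (P i).derivative - P i * (P j).derivative = P j * P i * (ℓ j - ℓ i) := by
          linear_combination hI i hi
        -- The left side has smaller degree than `P j * P i`.
        have hlt : (P j * (P i).derivative - P i * (P j).derivative).degree <
            (P j * P i).degree := by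
          refine (degree_sub_le _ _).trans_lt (max_lt ?_ ?_)
          · rw [degree_mul, degree_mul]
            exact WithBot.add_lt_add_left (degree_ne_bot.2 hPj) (degree_derivative_lt hne)
          · rw [mul_comm (P j), degree_mul, degree_mul]
            exact WithBot.add_lt_add_left (degree_ne_bot.2 hne) (degree_derivative_lt hPj)
        rw [heq, degree_mul (p := P j * P i)] at hlt
        have := zero_le_degree_iff.2 hij
        exact absurd hlt (not_lt.2 (le_add_of_nonneg_right this))
      refine hPj ((P j).eq_zero_of_infinite_isRoot ?_)
      have hz : ∀ᶠ s in 𝓝 (0 : E), (P j).IsRoot (algebraMap E K s) := by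
        filter_upwards [hP, hy0 j] with s hs hs0
        rw [Finset.sum_insert hj, Finset.sum_eq_zero fun i hi => by simp [hPi i hi], add_zero] at hs
        exact (mul_eq_zero.1 hs).resolve_right hs0
      exact ((infinite_of_mem_nhds (0 : E) hz).image (algebraMap E K).injective.injOn).mono
        (by rintro _ ⟨s, hs, rfl⟩; exact hs)

end LinearIndependence

/-! ### Zeros of exponential sums -/

section ExponentialSums

open Polynomial

variable {E K : Type*} [NontriviallyNormedField E] [NormedField K] [NormedAlgebra E K]

lemma eventually_norm_quadratic_lt (u v : E) {r : ℝ} (hr : 0 < r) :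
    ∀ᶠ s in 𝓝 (0 : E), ‖s * u + (2 * s + s ^ 2) * v‖ < r := by
  have h : Continuous fun s : E => ‖s * u + (2 * s + s ^ 2) * v‖ := by fun_prop
  have := h.tendsto 0
  simp only [zero_mul, mul_zero, ne_eq, OfNat.ofNat_ne_zero, not_false_eq_true, zero_pow, add_zero,
    norm_zero] at this
  exact this.eventually (gt_mem_nhds hr)

/-- If an exponential sum `∑ b i * exp (s * c i + ((1 + s)² - 1) * d i)` has zeros accumulating at
`s = 0`, then already the coefficients belonging to each value of the pair `(c, d)` sum to zero. -/
theorem sum_eq_zero_of_frequently_expSum_eq_zero (p : ℕ) [Fact p.Prime] [NormedAlgebra ℚ_[p] E]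
    [CompleteSpace E] {ι : Type*} (A : Finset ι) (b : ι → K)
    (c d : ι → E)
    (h : ∃ᶠ s in 𝓝[≠] (0 : E),
      ∑ i ∈ A, b i * algebraMap E K (exp (s * c i + (2 * s + s ^ 2) * d i)) = 0) (u v : E) :
    letI := Classical.decEq E
    ∑ i ∈ A with c i = u ∧ d i = v, b i = 0 := by
  classical
  have hE := charZero_of_padic p E
  have hp : (0 : ℝ) < 1 / p := one_div_pos.2 (by exact_mod_cast (Fact.out : p.Prime).pos)
  -- The sum is analytic near `0`, so it vanishes identically near `0`.
  have han : AnalyticAt E (fun s : E =>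
      ∑ i ∈ A, b i * algebraMap E K (exp (s * c i + (2 * s + s ^ 2) * d i))) 0 := by
    refine Finset.analyticAt_fun_sum _ fun i _ => analyticAt_const.mul ?_
    have h1 : AnalyticAt E (fun s : E => s * c i + (2 * s + s ^ 2) * d i) 0 := by fun_prop
    have h2 : AnalyticAt E (exp : E → E) (0 * c i + (2 * 0 + 0 ^ 2) * d i) := by
      refine padic_exp_analyticAt (p := p) ?_
      simpa using hp
    exact ((algebraMapCLM E K).analyticAt _).comp
      (AnalyticAt.fun_comp (f := fun s : E => s * c i + (2 * s + s ^ 2) * d i) h2 h1)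
  have hev := han.frequently_zero_iff_eventually_zero.1 h
  let y : E × E → E → K := fun w s => algebraMap E K (exp (s * w.1 + (2 * s + s ^ 2) * w.2))
  let ℓ : E × E → K[X] := fun w =>
    C (algebraMap E K (2 * w.2)) * X + C (algebraMap E K (w.1 + 2 * w.2))
  have hℓ : Function.Injective ℓ := by
    intro w w' hw
    have h1 := congrArg (fun P => P.coeff 1) hw
    have h0 := congrArg (fun P => P.coeff 0) hw
    simp only [ℓ, coeff_add, coeff_C_mul, coeff_X_one, coeff_C_zero, coeff_X_zero, mul_one,
      mul_zero, zero_add, coeff_C_succ, add_zero] at h1 h0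
    have h1' := mul_left_cancel₀ two_ne_zero ((algebraMap E K).injective h1)
    have h0' := (algebraMap E K).injective h0
    rw [h1'] at h0'
    exact Prod.ext (add_right_cancel h0') h1'
  have hy : ∀ w, ∀ᶠ s in 𝓝 (0 : E), HasDerivAt (y w) ((ℓ w).eval (algebraMap E K s) * y w s) s := by
    intro w
    filter_upwards [eventually_norm_quadratic_lt w.1 w.2 hp] with s hs
    have h1 : HasDerivAt (fun s : E => s * w.1 + (2 * s + s ^ 2) * w.2)
        (1 * w.1 + (2 * 1 + 2 * s) * w.2) s := by
      refine ((hasDerivAt_id s).mul_const _).add (HasDerivAt.mul_const ?_ _)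
      exact ((hasDerivAt_id s).const_mul 2).add (by simpa using! hasDerivAt_pow 2 s)
    have h2 := (padic_exp_hasDerivAt (p := p) hs).comp s h1
    have h3 := (algebraMapCLM E K).hasFDerivAt.comp_hasDerivAt s h2
    convert! h3 using 1
    simp only [ℓ, y, eval_add, eval_mul, eval_C, eval_X, ← map_mul, ← map_add, algebraMapCLM_apply]
    congr 1
    ring
  have hy0 : ∀ w, ∀ᶠ s in 𝓝 (0 : E), y w s ≠ 0 := by
    intro w
    filter_upwards [eventually_norm_quadratic_lt w.1 w.2 hp] with s hs
    exact (_root_.map_ne_zero _).2 (padic_exp_ne_zero (p := p) hs)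
  let B : Finset (E × E) := A.image fun i => (c i, d i)
  have hB := eq_zero_of_sum_polynomial_mul_eq_zero y ℓ hℓ hy hy0 B
    (fun w => C (∑ i ∈ A with (c i, d i) = w, b i)) (by
      filter_upwards [hev] with s hs
      rw [← hs, ← Finset.sum_fiberwise_of_maps_to (s := A) (t := B) (g := fun i => (c i, d i))
        fun i hi => Finset.mem_image_of_mem _ hi]
      refine Finset.sum_congr rfl fun w _ => ?_
      rw [eval_C, Finset.sum_mul]
      refine Finset.sum_congr rfl fun i hi => ?_
      rw [← (Finset.mem_filter.1 hi).2])
  have key : ∑ i ∈ A with (c i, d i) = (u, v), b i = 0 := by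
    by_cases hw : (u, v) ∈ B
    · exact C_eq_zero.1 (hB _ hw)
    · refine Finset.sum_eq_zero fun i hi => absurd ?_ hw
      rw [← (Finset.mem_filter.1 hi).2]
      exact Finset.mem_image_of_mem _ (Finset.mem_filter.1 hi).1
  simp only [Prod.mk.injEq] at key
  convert key

end ExponentialSums

/-! ### Logarithms of continuous characters -/

section Logarithm

variable {p : ℕ} [Fact p.Prime] {E : Type*} [NontriviallyNormedField E] [NormedAlgebra ℚ_[p] E]
  [CompleteSpace E] [IsUltrametricDist E]

omit [CompleteSpace E] in
lemma norm_nsmul_lt {r : ℝ} (hr : 0 < r) {x : E} (hx : ‖x‖ < r) (n : ℕ) : ‖n • x‖ < r := by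
  induction n with
  | zero => simpa
  | succ n ih =>
    rw [succ_nsmul]
    exact (IsUltrametricDist.norm_add_le_max _ _).trans_lt (max_lt ih hx)

variable (p) in
/-- The logarithm of a continuous `p`-adic character of a compact abelian group. It inverts the
exponential on an open subgroup `V`, and the character has finite order on its kernel. -/
theorem exists_logarithm {π : Type*} [CommGroup π] [TopologicalSpace π] [IsTopologicalGroup π]
    [CompactSpace π] (χ : π →* E) (hχ : Continuous χ) :
    ∃ (f : π →* Multiplicative E) (V : Subgroup π) (M : ℕ), Continuous (fun g => (f g).toAdd) ∧
      IsOpen (V : Set π) ∧ 0 < M ∧ (∀ g, (f g).toAdd = 0 → χ g ^ M = 1) ∧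
      ∀ g ∈ V, ‖(f g).toAdd‖ < 1 / p ∧ χ g = exp (f g).toAdd := by
  have hE := charZero_of_padic p E
  obtain ⟨r, hr, hrp, hinj, hnhds⟩ := exists_exp_injOn_ball p E
  have hadd : ∀ {x y : E}, ‖x‖ < r → ‖y‖ < r → exp (x + y) = exp x * exp y := fun hx hy =>
    padic_exp_add (hx.trans_le hrp) (hy.trans_le hrp)
  have hsum : ∀ {x y : E}, ‖x‖ < r → ‖y‖ < r → ‖x + y‖ < r := fun hx hy =>
    (IsUltrametricDist.norm_add_le_max _ _).trans_lt (max_lt hx hy)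
  have hunique : ∀ {x y : E}, ‖x‖ < r → ‖y‖ < r → exp x = exp y → x = y := fun hx hy h =>
    hinj (by simpa using hx) (by simpa using hy) h
  -- `V` is the preimage of the image of a small ball under the exponential.
  let V : Subgroup π :=
    { carrier := {g | ∃ c : E, ‖c‖ < r ∧ exp c = χ g}
      one_mem' := ⟨0, by simpa using hr, by simp⟩
      mul_mem' := by
        rintro g h ⟨c, hc, hcg⟩ ⟨d, hd, hdh⟩
        exact ⟨c + d, hsum hc hd, by rw [hadd hc hd, hcg, hdh, map_mul]⟩
      inv_mem' := by
        rintro g ⟨c, hc, hcg⟩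
        refine ⟨-c, by rwa [norm_neg], ?_⟩
        have h1 : exp (-c) * exp c = 1 := by
          rw [← hadd (by rwa [norm_neg]) hc, neg_add_cancel, exp_zero]
        have h2 : χ g⁻¹ * χ g = 1 := by rw [← map_mul, inv_mul_cancel, map_one]
        refine mul_right_cancel₀ (padic_exp_ne_zero (hc.trans_le hrp)) (h1.trans ?_)
        rw [hcg, h2] }
  have hball : ∀ r' : ℝ, 0 < r' → {g | ∃ c : E, ‖c‖ < r' ∧ exp c = χ g} ∈ 𝓝 (1 : π) := by
    intro r' hr'
    have := hχ.continuousAt (x := 1) (by rw [map_one]; exact hnhds r' hr')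
    filter_upwards [this] with g hg
    obtain ⟨c, hc, hcg⟩ := hg
    exact ⟨c, by simpa using hc, hcg⟩
  have hVopen : IsOpen (V : Set π) := V.isOpen_of_mem_nhds (g := 1) (hball r hr)
  have hfin : Finite (π ⧸ V) := V.quotient_finite_of_isOpen hVopen
  have hVfi : V.FiniteIndex := V.finiteIndex_of_finite_quotient
  have hM : V.index ≠ 0 := hVfi.index_ne_zero
  have hM' : (V.index : E) ≠ 0 := Nat.cast_ne_zero.2 hM
  have hpow : ∀ g, ∃ c : E, ‖c‖ < r ∧ exp c = χ (g ^ V.index) := fun g => V.pow_index_mem g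
  choose ℓ hℓr hℓ using hpow
  have hℓmul : ∀ g h, ℓ (g * h) = ℓ g + ℓ h := fun g h => by
    refine hunique (hℓr _) (hsum (hℓr _) (hℓr _)) ?_
    rw [hℓ, hadd (hℓr _) (hℓr _), hℓ, hℓ, mul_pow, map_mul]
  -- Powers by the index of `V` land in `V`, so dividing by the index extends the logarithm to `π`.
  let f : π →* Multiplicative E := MonoidHom.mk' (fun g => .ofAdd (ℓ g / V.index)) fun g h => by
    rw [hℓmul, add_div, ofAdd_add]
  have hexp : ∀ (n : ℕ) {x : E}, ‖x‖ < r → exp (n • x) = exp x ^ n := by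
    intro n x hx
    induction n with
    | zero => simp
    | succ n ih => rw [succ_nsmul, hadd (norm_nsmul_lt hr hx n) hx, ih, pow_succ]
  have hfV : ∀ g (c : E), ‖c‖ < r → exp c = χ g → (f g).toAdd = c := by
    intro g c hc hcg
    have h1 : ℓ g = V.index • c := by
      refine hunique (hℓr _) (norm_nsmul_lt hr hc _) ?_
      rw [hℓ, hexp _ hc, hcg, map_pow]
    change ℓ g / V.index = c
    rw [h1, nsmul_eq_mul, mul_div_cancel_left₀ _ hM']
  refine ⟨f, V, V.index, ?_, hVopen, Nat.pos_of_ne_zero hM, fun g hg => ?_, fun g hg => ?_⟩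
  · have hcont : Continuous f := by
      refine continuous_of_continuousAt_one f ?_
      rw [ContinuousAt, map_one]
      have : Tendsto (fun g => (f g).toAdd) (𝓝 1) (𝓝 0) := by
        rw [Metric.tendsto_nhds]
        intro ε hε
        filter_upwards [hball (min r ε) (lt_min hr hε)] with g hg
        obtain ⟨c, hc, hcg⟩ := hg
        rw [hfV g c (hc.trans_le (min_le_left _ _)) hcg, dist_zero_right]
        exact hc.trans_le (min_le_right _ _)
      exact (continuous_ofAdd.tendsto _).comp this
    exact continuous_toAdd.comp hcont
  · have h0 : ℓ g = 0 := (div_eq_zero_iff.1 hg).resolve_right hM'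
    rw [← map_pow, ← hℓ, h0, exp_zero]
  · obtain ⟨c, hc, hcg⟩ := hg
    rw [hfV g c hc hcg]
    exact ⟨hc.trans_le hrp, hcg.symm⟩

end Logarithm

/-! ### Relations in pro-p completions -/

section ProPRelations

variable {p : ℕ} [Fact p.Prime]

/-- The canonical map from `G` to its pro-`p` completion. -/
def ProP.of (p : ℕ) [Fact p.Prime] {G : Type*} [CommGroup G] [TopologicalSpace G] (g : G) :
    ProP p G :=
  ⟨fun _ => Additive.ofMul (QuotientGroup.mk g), fun _ _ _ => rfl⟩

lemma PadicInt.toZModPow_eq_appr (z : ℤ_[p]) {k n : ℕ} (hk : k ≤ n) :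
    PadicInt.toZModPow k z = ((z.appr n : ℕ) : ZMod (p ^ k)) := by
  rw [← PadicInt.zmod_cast_comp_toZModPow k n hk]
  have h : PadicInt.toZModPow n z = ((z.appr n : ℕ) : ZMod (p ^ n)) := rfl
  rw [RingHom.comp_apply, h, map_natCast]

variable {E : Type*} [NormedField E] [NormedAlgebra ℚ_[p] E] [IsUltrametricDist E]
  {G : Type*} [CommGroup G] [TopologicalSpace G] [IsTopologicalGroup G] [CompactSpace G]

/-- The preimage of a ball under a continuous homomorphism from a compact group to `E`, as an open
subgroup of `p`-power index. -/
def ballPreimage (f : G →* Multiplicative E) (hf : Continuous fun g => (f g).toAdd) (ε : ℝ)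
    (hε : 0 < ε) : OpenPSubgroup p G where
  toSubgroup :=
    { carrier := {g | ‖(f g).toAdd‖ < ε}
      one_mem' := by simpa using hε
      mul_mem' := fun {a b} ha hb => by
        rw [Set.mem_ofPred_eq, map_mul, toAdd_mul]
        exact (IsUltrametricDist.norm_add_le_max _ _).trans_lt (max_lt ha hb)
      inv_mem' := fun {a} ha => by
        rw [Set.mem_ofPred_eq, map_inv, toAdd_inv, norm_neg]
        exact ha }
  isOpen := isOpen_lt hf.norm continuous_const
  exists_index_eq := by
    set U : Subgroup G := _
    change ∃ k, U.index = p ^ k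
    have hU : IsOpen (U : Set G) := isOpen_lt hf.norm continuous_const
    have hfin : Finite (G ⧸ U) := U.quotient_finite_of_isOpen hU
    obtain ⟨C, hC⟩ := (isCompact_range hf).isBounded.exists_norm_le
    obtain ⟨k, hk⟩ : ∃ k : ℕ, C * ‖(p : ℚ_[p]) ^ k‖ < ε := by
      have : Tendsto (fun k : ℕ => C * ‖(p : ℚ_[p]) ^ k‖) atTop (𝓝 (C * ‖(0 : ℚ_[p])‖)) :=
        ((tendsto_pow_atTop_nhds_zero_of_norm_lt_one Padic.norm_p_lt_one).norm).const_mul C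
      rw [norm_zero, mul_zero] at this
      exact (this.eventually (gt_mem_nhds hε)).exists
    have hpg : IsPGroup p (G ⧸ U) := by
      intro x
      obtain ⟨g, rfl⟩ := QuotientGroup.mk_surjective x
      refine ⟨k, ?_⟩
      rw [← QuotientGroup.mk_pow, QuotientGroup.eq_one_iff]
      change ‖(f (g ^ p ^ k)).toAdd‖ < ε
      rw [map_pow, toAdd_pow, ← Nat.cast_smul_eq_nsmul ℚ_[p], norm_smul, mul_comm]
      push_cast
      exact (mul_le_mul_of_nonneg_right (hC _ ⟨g, rfl⟩) (norm_nonneg _)).trans_lt hk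
    exact IsPGroup.iff_card.1 hpg

lemma mem_ballPreimage {f : G →* Multiplicative E} {hf : Continuous fun g => (f g).toAdd} {ε : ℝ}
    {hε : 0 < ε} {g : G} :
    g ∈ (ballPreimage (p := p) f hf ε hε).toSubgroup ↔ ‖(f g).toAdd‖ < ε := Iff.rfl

/-- Relations over `ℤ_p` in the pro-`p` completion are respected by continuous homomorphisms to
`p`-adic fields. -/
lemma smul_eq_smul_of_ProP (f : G →* Multiplicative E) (hf : Continuous fun g => (f g).toAdd)
    {s t : ℤ_[p]} {g h : G} (hst : s • ProP.of p g = t • ProP.of p h) :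
    (s : ℚ_[p]) • (f g).toAdd = (t : ℚ_[p]) • (f h).toAdd := by
  refine sub_eq_zero.1 (norm_le_zero_iff.1 (le_of_forall_pos_lt_add fun ε hε => ?_))
  rw [zero_add]
  set U := ballPreimage (p := p) f hf ε hε with hUdef
  -- Approximate `s` and `t` by natural numbers, both modulo the exponent of `G / U` and in norm.
  have happ : ∀ C : ℝ, ∃ n, U.exponent ≤ n ∧ (p : ℝ) ^ (-n : ℤ) * C < ε := by
    intro C
    have h1 : Tendsto (fun n : ℕ => (p : ℝ) ^ (-n : ℤ) * C) atTop (𝓝 (0 * C)) := by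
      refine Tendsto.mul_const _ ?_
      have := tendsto_pow_atTop_nhds_zero_of_lt_one (r := (p : ℝ)⁻¹) (by positivity)
        (inv_lt_one_of_one_lt₀ (by exact_mod_cast (Fact.out : p.Prime).one_lt))
      simpa using this
    rw [zero_mul] at h1
    obtain ⟨n, h2, h3⟩ := ((h1.eventually (gt_mem_nhds hε)).and (eventually_ge_atTop U.exponent)).exists
    exact ⟨n, h3, h2⟩
  have happrox : ∀ (s : ℤ_[p]) (x : E), ∃ m : ℕ,
      PadicInt.toZModPow U.exponent s = (m : ZMod (p ^ U.exponent)) ∧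
      ‖(s : ℚ_[p]) • x - m • x‖ < ε := by
    intro s x
    obtain ⟨n, hn, hnε⟩ := happ ‖x‖
    refine ⟨s.appr n, PadicInt.toZModPow_eq_appr s hn, ?_⟩
    rw [← Nat.cast_smul_eq_nsmul ℚ_[p], ← sub_smul, norm_smul]
    refine (mul_le_mul_of_nonneg_right ?_ (norm_nonneg _)).trans_lt hnε
    have := (PadicInt.norm_le_pow_iff_mem_span_pow _ n).2 (PadicInt.appr_spec n s)
    rw [PadicInt.norm_def] at this
    simpa using this
  obtain ⟨m, hm, hmε⟩ := happrox s (f g).toAdd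
  obtain ⟨m', hm', hmε'⟩ := happrox t (f h).toAdd
  have h1 : s • (ProP.of p g).1 U = t • (ProP.of p h).1 U :=
    congrFun (congrArg Subtype.val hst) U
  rw [U.smul_eq s _ m hm, U.smul_eq t _ m' hm'] at h1
  have h2 : (QuotientGroup.mk (g ^ m) : G ⧸ U.toSubgroup) = QuotientGroup.mk (h ^ m') := h1
  rw [QuotientGroup.eq, hUdef, mem_ballPreimage, map_mul, map_inv, map_pow, map_pow, toAdd_mul,
    toAdd_inv, toAdd_pow, toAdd_pow] at h2
  have h3 : (s : ℚ_[p]) • (f g).toAdd - (t : ℚ_[p]) • (f h).toAdd =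
      ((s : ℚ_[p]) • (f g).toAdd - m • (f g).toAdd) - ((t : ℚ_[p]) • (f h).toAdd - m' • (f h).toAdd)
      - (-(m • (f g).toAdd) + m' • (f h).toAdd) := by abel
  have hmax : ∀ {x y : E}, ‖x‖ < ε → ‖y‖ < ε → ‖x - y‖ < ε := fun {x y} hx hy => by
    rw [sub_eq_add_neg]
    exact (IsUltrametricDist.norm_add_le_max _ _).trans_lt (max_lt hx (by rwa [norm_neg]))
  rw [h3]
  exact hmax (hmax hmε hmε') h2

/-- The same for relations after inverting `p`, since `E` has no `ℤ_p`-torsion. -/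
lemma eq_smul_of_RatProP (f : G →* Multiplicative E) (hf : Continuous fun g => (f g).toAdd)
    {a : ℤ_[p]} {g h : G} (hgh : (1 : ℚ_[p]) ⊗ₜ[ℤ_[p]] ProP.of p g =
      (a : ℚ_[p]) • ((1 : ℚ_[p]) ⊗ₜ[ℤ_[p]] ProP.of p h)) :
    (f g).toAdd = (a : ℚ_[p]) • (f h).toAdd := by
  have h1 : (a : ℚ_[p]) • ((1 : ℚ_[p]) ⊗ₜ[ℤ_[p]] ProP.of p h) =
      (1 : ℚ_[p]) ⊗ₜ[ℤ_[p]] (a • ProP.of p h) := by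
    rw [TensorProduct.smul_tmul', TensorProduct.tmul_smul, TensorProduct.smul_tmul']
    congr 1
  rw [h1] at hgh
  obtain ⟨s, hs⟩ := (IsLocalizedModule.eq_iff_exists (nonZeroDivisors ℤ_[p])
    (TensorProduct.mk ℤ_[p] ℚ_[p] (ProP p G) 1)).1 hgh
  have hs0 : ((s : ℤ_[p]) : ℚ_[p]) ≠ 0 := by
    simp
  have h2 : (s : ℤ_[p]) • ProP.of p g = ((s : ℤ_[p]) * a) • ProP.of p h := by
    rw [mul_smul]; exact hs
  have h3 := smul_eq_smul_of_ProP f hf h2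
  rw [PadicInt.coe_mul, mul_smul] at h3
  exact smul_right_injective E hs0 h3

end ProPRelations

/-! ### The action of the automorphism on logarithms -/

section Iterates

instance (Γ : Type u) [CommGroup Γ] : CompactSpace (ProfComp Γ) :=
  inferInstanceAs (CompactSpace (ProfiniteGrp.ProfiniteCompletion.completion (GrpCat.of Γ)))

lemma ProfComp.denseRange_of (Γ : Type u) [CommGroup Γ] : DenseRange (ProfComp.of Γ) :=
  ProfiniteGrp.ProfiniteCompletion.denseRange (GrpCat.of Γ)

variable {p : ℕ} [Fact p.Prime] {E : Type*} [NormedField E] [NormedAlgebra ℚ_[p] E]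
  [IsUltrametricDist E] {π ν : Type*} [CommGroup π] [TopologicalSpace π] [IsTopologicalGroup π]
  [CompactSpace π] [CommGroup ν] [TopologicalSpace ν]

/-- Let `σ` act on the rationalised pro-`p` completion as `a ^ 2` on the image of `ν` and as `a` on
the quotient by `ν`. Then `(σ - a ^ 2) (σ - a)` kills every continuous homomorphism to `E`. -/
theorem toAdd_map_map_eq (i : ν →ₜ* π) (σ : π →ₜ* π) (a : ℤ_[p])
    (hsub : ∀ v : RatProP p ν, RatProP.map p σ (RatProP.map p i v) =
      ((a ^ 2 : ℤ_[p]) : ℚ_[p]) • RatProP.map p i v)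
    (hquot : ∀ v : RatProP p π, RatProP.map p (quotientHom i.toMonoidHom.range) (RatProP.map p σ v) =
      (a : ℚ_[p]) • RatProP.map p (quotientHom i.toMonoidHom.range) v)
    (f : π →* Multiplicative E) (hf : Continuous fun g => (f g).toAdd) (g : π) :
    (f (σ (σ g))).toAdd - (a : ℚ_[p]) ^ 2 • (f (σ g)).toAdd =
      (a : ℚ_[p]) • ((f (σ g)).toAdd - (a : ℚ_[p]) ^ 2 • (f g).toAdd) := by
  have hi : ∀ n : ν, (f (σ (i n))).toAdd = (a : ℚ_[p]) ^ 2 • (f (i n)).toAdd := by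
    intro n
    have := eq_smul_of_RatProP (a := a ^ 2) (g := σ (i n)) (h := i n) f hf
      (hsub (1 ⊗ₜ ProP.of p n))
    rwa [PadicInt.coe_pow] at this
  let h : π →* Multiplicative E := MonoidHom.mk'
    (fun g => .ofAdd ((f (σ g)).toAdd - (a : ℚ_[p]) ^ 2 • (f g).toAdd)) fun g g' => by
      rw [← ofAdd_add]
      simp only [map_mul, toAdd_mul, smul_add]
      congr 1
      abel
  have hh : Continuous fun g => (h g).toAdd :=
    (hf.comp σ.continuous_toFun).sub (hf.const_smul ((a : ℚ_[p]) ^ 2))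
  -- `h = f ∘ σ - a ^ 2 • f` kills the image of `ν`, hence descends to the quotient.
  let N := i.toMonoidHom.range
  have hN : N ≤ h.ker := by
    rintro _ ⟨n, rfl⟩
    change Multiplicative.ofAdd ((f (σ (i n))).toAdd - (a : ℚ_[p]) ^ 2 • (f (i n)).toAdd) = 1
    rw [hi, sub_self, ofAdd_zero]
  let hbar : π ⧸ N →* Multiplicative E := QuotientGroup.lift N h hN
  have hbarc : Continuous fun g => (hbar g).toAdd := by
    refine (QuotientGroup.isQuotientMap_mk (N := N)).continuous_iff.2 ?_
    exact hh
  exact eq_smul_of_RatProP (g := quotientHom N (σ g)) (h := quotientHom N g) hbar hbarc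
    (hquot (1 ⊗ₜ ProP.of p g))

/-- The iterates of `σ` on continuous homomorphisms to `E`, decomposed along the eigenvalues `a`
and `a ^ 2`. -/
theorem exists_eigen_decomposition (i : ν →ₜ* π) (σ : π →ₜ* π) (a : ℤ_[p]) (ha0 : a ≠ 0)
    (ha1 : a ≠ 1)
    (hsub : ∀ v : RatProP p ν, RatProP.map p σ (RatProP.map p i v) =
      ((a ^ 2 : ℤ_[p]) : ℚ_[p]) • RatProP.map p i v)
    (hquot : ∀ v : RatProP p π, RatProP.map p (quotientHom i.toMonoidHom.range) (RatProP.map p σ v) =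
      (a : ℚ_[p]) • RatProP.map p (quotientHom i.toMonoidHom.range) v)
    (f : π →* Multiplicative E) (hf : Continuous fun g => (f g).toAdd) :
    ∃ c d : π →* Multiplicative E, ∀ (n : ℕ) (g : π), (f (σ^[n] g)).toAdd =
      algebraMap ℚ_[p] E a ^ n * (c g).toAdd + algebraMap ℚ_[p] E a ^ (2 * n) * (d g).toAdd := by
  set b : E := algebraMap ℚ_[p] E a with hb
  have hinj := (algebraMap ℚ_[p] E).injective
  have hb0 : b ≠ 0 := by
    rw [hb, Ne, map_eq_zero]; exact fun h => ha0 (PadicInt.ext h)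
  have hb1 : 1 - b ≠ 0 := by
    rw [sub_ne_zero, hb, ← map_one (algebraMap ℚ_[p] E)]
    exact fun h => ha1 (PadicInt.ext (hinj h).symm)
  have hD : b - b ^ 2 ≠ 0 := by
    have : b - b ^ 2 = b * (1 - b) := by ring
    rw [this]; exact mul_ne_zero hb0 hb1
  have hrec : ∀ g, (f (σ (σ g))).toAdd = (b + b ^ 2) * (f (σ g)).toAdd - b ^ 3 * (f g).toAdd := by
    intro g
    have := toAdd_map_map_eq i σ a hsub hquot f hf g
    simp only [Algebra.smul_def, map_pow] at this
    linear_combination this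
  -- `c` and `d` are the components of `f` for the eigenvalues `a` and `a ^ 2`, which are distinct.
  let c : π →* Multiplicative E := MonoidHom.mk'
    (fun g => .ofAdd (((f (σ g)).toAdd - b ^ 2 * (f g).toAdd) / (b - b ^ 2))) fun g g' => by
      rw [← ofAdd_add]
      simp only [map_mul, toAdd_mul]
      congr 1
      ring
  let d : π →* Multiplicative E := MonoidHom.mk'
    (fun g => .ofAdd ((b * (f g).toAdd - (f (σ g)).toAdd) / (b - b ^ 2))) fun g g' => by
      rw [← ofAdd_add]
      simp only [map_mul, toAdd_mul]
      congr 1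
      ring
  have hc : ∀ g, (c g).toAdd = ((f (σ g)).toAdd - b ^ 2 * (f g).toAdd) / (b - b ^ 2) := fun _ => rfl
  have hd : ∀ g, (d g).toAdd = (b * (f g).toAdd - (f (σ g)).toAdd) / (b - b ^ 2) := fun _ => rfl
  refine ⟨c, d, fun n => ?_⟩
  induction n with
  | zero =>
    intro g
    rw [hc, hd, Function.iterate_zero, id]
    field_simp
    ring
  | succ n ih =>
    intro g
    rw [Function.iterate_succ_apply, ih, hc, hd, hc, hd, hrec]
    field_simp
    ring

end Iterates

/-! ### Finite extensions of the p-adic numbers -/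

section FiniteExtension

variable {p : ℕ} [Fact p.Prime] (E : IntermediateField ℚ_[p] (PadicAlgCl p))

instance : NontriviallyNormedField E :=
  { (inferInstance : NormedField E) with
    non_trivial := by
      obtain ⟨x, hx⟩ := NontriviallyNormedField.non_trivial (α := ℚ_[p])
      exact ⟨algebraMap ℚ_[p] E x, by rwa [norm_algebraMap']⟩ }

instance : IsUltrametricDist E :=
  ⟨fun x y z => IsUltrametricDist.dist_triangle_max (x : PadicAlgCl p) y z⟩

instance : NormedAlgebra E (PadicAlgCl p) where
  norm_smul_le x y := (norm_mul_le (x : PadicAlgCl p) y)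

end FiniteExtension

/-! ### Periodicity modulo open subgroups -/

section Periodicity

/-- An automorphism of the profinite completion of a finitely generated group has finite order
modulo every open subgroup. -/
theorem exists_iterate_mem_of_isOpen {Γ : Type u} [CommGroup Γ] [Group.FG Γ]
    (σ : ProfComp Γ ≃ₜ* ProfComp Γ) (V : Subgroup (ProfComp Γ)) (hV : IsOpen (V : Set (ProfComp Γ))) :
    ∃ N : ℕ, 0 < N ∧ ∀ g, σ^[N] g / g ∈ V := by
  have hfin : Finite (ProfComp Γ ⧸ V) := V.quotient_finite_of_isOpen hV
  obtain ⟨T, hT⟩ := Group.fg_def.1 (inferInstance : Group.FG Γ)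
  have hit : ∀ (n : ℕ) (g h : ProfComp Γ), σ^[n] (g * h) = σ^[n] g * σ^[n] h := fun n g h =>
    Function.Semiconj₂.iterate (map_mul σ) n g h
  let q : ℕ → Γ →* ProfComp Γ ⧸ V := fun n =>
    (QuotientGroup.mk' V).comp
      ((MonoidHom.mk' (σ^[n]) (hit n)).comp (ProfComp.of Γ))
  -- There are only finitely many homomorphisms from `Γ` to the finite quotient by `V`.
  obtain ⟨i, j, hij, hq⟩ : ∃ i j, i < j ∧ q i = q j := by
    obtain ⟨i, j, hij, h⟩ := Finite.exists_ne_map_eq_of_infinite fun n => fun t : T => q n t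
    have hq : q i = q j := MonoidHom.eq_of_eqOn_dense hT fun t ht => congrFun h ⟨t, ht⟩
    rcases lt_or_gt_of_ne hij with h | h
    · exact ⟨i, j, h, hq⟩
    · exact ⟨j, i, h, hq.symm⟩
  have hcont : ∀ n, Continuous (σ^[n]) := fun n => σ.continuous_toFun.iterate n
  have hmem : ∀ g, σ^[j] g / σ^[i] g ∈ V := by
    have hcl : IsClosed {g | σ^[j] g / σ^[i] g ∈ V} :=
      (V.isClosed_of_isOpen hV).preimage ((hcont j).div' (hcont i))
    intro g
    refine (ProfComp.denseRange_of Γ).induction_on (p := fun g => σ^[j] g / σ^[i] g ∈ V) g hcl ?_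
    intro γ
    have := DFunLike.congr_fun hq γ
    exact (QuotientGroup.eq_iff_div_mem).1 this.symm
  refine ⟨j - i, Nat.sub_pos_of_lt hij, fun g => ?_⟩
  obtain ⟨h, rfl⟩ : ∃ h, σ^[i] h = g := (σ.surjective.iterate i) g
  rw [← Function.iterate_add_apply, Nat.sub_add_cancel hij.le]
  exact hmem h

lemma iterate_mul_mem {π : Type*} [CommGroup π] {σ : π → π} {V : Subgroup π} {N : ℕ}
    (h : ∀ g, σ^[N] g / g ∈ V) (n : ℕ) (g : π) : σ^[N * n] g / g ∈ V := by
  induction n generalizing g with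
  | zero => simp
  | succ n ih =>
    rw [Nat.mul_succ, Function.iterate_add_apply]
    have := V.mul_mem (ih (σ^[N] g)) (h g)
    rwa [div_mul_div_cancel] at this

/-- The positive powers of a `p`-adic unit accumulate at `1`. -/
lemma exists_pow_norm_sub_one_lt {p : ℕ} [Fact p.Prime] (a : ℤ_[p]ˣ) {ε : ℝ} (hε : 0 < ε) :
    ∃ n, 0 < n ∧ ‖(a : ℤ_[p]) ^ n - 1‖ < ε := by
  obtain ⟨k, hk⟩ := PadicInt.exists_pow_neg_lt p hε
  refine ⟨(p ^ k).totient, Nat.totient_pos.2 (pow_pos (Fact.out : p.Prime).pos k), ?_⟩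
  refine lt_of_le_of_lt ((PadicInt.norm_le_pow_iff_mem_span_pow _ k).2 ?_) hk
  rw [← PadicInt.ker_toZModPow, RingHom.mem_ker, map_sub, map_pow, map_one, sub_eq_zero]
  have := ZMod.pow_totient (Units.map (PadicInt.toZModPow (p := p) k).toMonoidHom a)
  exact congrArg Units.val this

end Periodicity

/-! ### Orbits of characters -/

section Orbits

variable {p : ℕ} [Fact p.Prime] {Γ : Type u} [CommGroup Γ]

lemma ContChar.iterate_comp_apply {π : Type*} [CommGroup π] [TopologicalSpace π] (σ : π →ₜ* π)
    (χ : ContChar p π) (n : ℕ) (g : π) :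
    (((fun χ : ContChar p π => χ.comp σ)^[n]) χ).1 g = χ.1 (σ^[n] g) := by
  induction n generalizing χ with
  | zero => rfl
  | succ n ih =>
    rw [Function.iterate_succ_apply, ih, Function.iterate_succ_apply']
    rfl

lemma CharVar.mem_point_iff {K : Type*} [Field K] (χ : Γ →* Kˣ) (Q : MonoidAlgebra K Γ) :
    Q ∈ (CharVar.point χ).asIdeal ↔ ∑ γ ∈ Q.coeff.support, Q.coeff γ * (χ γ : K) = 0 := by
  change MonoidAlgebra.lift K K Γ ((Units.coeHom K).comp χ) Q = 0 ↔ _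
  rw [MonoidAlgebra.lift_apply', Finsupp.sum]
  rfl

/-- Let the orbit of `χ` under `σ` lie in the closed set defined by `I`. Then there is a saturated
subgroup `N₀` of `Γ` on which `χ` has finite order, such that the coset of `χ` under the torus
`Spec K[Γ/N₀]` lies in that closed set. -/
theorem exists_subgroup_of_orbit [Group.FG Γ] (Γn : Subgroup Γ) (σ : ProfComp Γ ≃ₜ* ProfComp Γ)
    (α : ℤ_[p]ˣ) (hα : ¬ IsOfFinOrder α)
    (hsub : ∀ v : RatProP p (ProfComp Γn),
      RatProP.map p (σ : ProfComp Γ →ₜ* ProfComp Γ)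
          (RatProP.map p (ProfComp.map Γn.subtype) v) =
        (((α⁻¹ ^ 2 : ℤ_[p]ˣ) : ℤ_[p]) : ℚ_[p]) • RatProP.map p (ProfComp.map Γn.subtype) v)
    (hquot : ∀ v : RatProP p (ProfComp Γ),
      RatProP.map p (quotientHom (ProfComp.map Γn.subtype).toMonoidHom.range)
          (RatProP.map p (σ : ProfComp Γ →ₜ* ProfComp Γ) v) =
        (((α⁻¹ : ℤ_[p]ˣ) : ℤ_[p]) : ℚ_[p]) •
          RatProP.map p (quotientHom (ProfComp.map Γn.subtype).toMonoidHom.range) v)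
    (I : Set (MonoidAlgebra (PadicAlgCl p) Γ)) (χ : ContChar p (ProfComp Γ))
    (hI : ∀ Q ∈ I, ∀ n : ℕ, Q ∈ (ContChar.phi
      (((fun χ : ContChar p (ProfComp Γ) => χ.comp (σ : ProfComp Γ →ₜ* ProfComp Γ))^[n])
        χ)).asIdeal) :
    ∃ (N₀ : Subgroup Γ) (M : ℕ), 0 < M ∧ (∀ γ ∈ N₀, χ.1 (ProfComp.of Γ γ) ^ M = 1) ∧
      (∀ (γ : Γ) (n : ℕ), 0 < n → γ ^ n ∈ N₀ → γ ∈ N₀) ∧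
      ∀ Q ∈ I, ∀ γ₀ : Γ,
        letI := Classical.decPred (· ∈ N₀)
        ∑ γ ∈ Q.coeff.support with γ / γ₀ ∈ N₀,
          Q.coeff γ * (χ.1 (ProfComp.of Γ γ) : PadicAlgCl p) = 0 := by
  classical
  obtain ⟨E, hE, hχE⟩ := χ.2
  have hcomplete : CompleteSpace E := FiniteDimensional.complete ℚ_[p] E
  have hchar := charZero_of_padic p E
  let χE : ProfComp Γ →* E :=
    { toFun := fun g => ⟨χ.1 g, hχE g⟩
      map_one' := Subtype.ext (by simp)
      map_mul' := fun g h => Subtype.ext (by simp) }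
  have hχEc : Continuous χE :=
    (Units.continuous_val.comp χ.1.continuous_toFun).subtype_mk _
  obtain ⟨f, V, M, hf, hV, hM, hfM, hfV⟩ := exists_logarithm p χE hχEc
  have ha1 : ((α⁻¹ : ℤ_[p]ˣ) : ℤ_[p]) ≠ 1 := fun h => hα (by
    rw [inv_eq_one.1 (Units.ext h)]
    exact IsOfFinOrder.one)
  obtain ⟨c, d, hcd⟩ := exists_eigen_decomposition (E := E) (ProfComp.map Γn.subtype)
    (σ : ProfComp Γ →ₜ* ProfComp Γ) ((α⁻¹ : ℤ_[p]ˣ) : ℤ_[p]) (Units.ne_zero _) ha1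
    hsub hquot f hf
  obtain ⟨N, hN, hNV⟩ := exists_iterate_mem_of_isOpen σ V hV
  set b : E := algebraMap ℚ_[p] E ((α⁻¹ : ℤ_[p]ˣ) : ℤ_[p]) with hb
  have hfcd : ∀ g, (f g).toAdd = (c g).toAdd + (d g).toAdd := fun g => by
    simpa using hcd 0 g
  let C : Γ →* Multiplicative E := c.comp (ProfComp.of Γ)
  let D : Γ →* Multiplicative E := d.comp (ProfComp.of Γ)
  -- With `s = b ^ (N * n) - 1`, the logarithm changes by `s * C + ((1 + s) ^ 2 - 1) * D`.
  have horbit : ∀ (n : ℕ) (γ : Γ), (χ.1 (σ^[N * n] (ProfComp.of Γ γ)) : PadicAlgCl p) =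
      χ.1 (ProfComp.of Γ γ) * algebraMap E (PadicAlgCl p)
        (exp ((b ^ (N * n) - 1) * (C γ).toAdd +
          (2 * (b ^ (N * n) - 1) + (b ^ (N * n) - 1) ^ 2) * (D γ).toAdd)) := by
    intro n γ
    set g := ProfComp.of Γ γ with hg
    have h1 := (hfV _ (iterate_mul_mem hNV n g)).2
    have h2 : (f (σ^[N * n] g / g)).toAdd = (b ^ (N * n) - 1) * (C γ).toAdd +
          (2 * (b ^ (N * n) - 1) + (b ^ (N * n) - 1) ^ 2) * (D γ).toAdd := by
      rw [map_div, toAdd_div, hfcd g]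
      have := hcd (N * n) g
      change (f (σ^[N * n] g)).toAdd = _ at this
      rw [this]
      change _ = (b ^ (N * n) - 1) * (c g).toAdd +
          (2 * (b ^ (N * n) - 1) + (b ^ (N * n) - 1) ^ 2) * (d g).toAdd
      ring
    rw [← h2, ← h1]
    change _ = (χ.1 g : PadicAlgCl p) * (χ.1 (σ^[N * n] g / g) : PadicAlgCl p)
    rw [← Units.val_mul, ← map_mul, mul_div_cancel]
  have hfreq : ∀ P : E → Prop, (∀ n : ℕ, P (b ^ (N * n) - 1)) → ∃ᶠ s in 𝓝[≠] (0 : E), P s := by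
    intro P hP
    rw [frequently_iff]
    intro U hU
    obtain ⟨ε, hε, hεU⟩ := Metric.mem_nhdsWithin_iff.1 hU
    obtain ⟨n, hn, hnε⟩ := exists_pow_norm_sub_one_lt (α⁻¹ ^ N) hε
    have hs : b ^ (N * n) - 1 = algebraMap ℚ_[p] E
        ((((α⁻¹ ^ N : ℤ_[p]ˣ) : ℤ_[p]) ^ n - 1 : ℤ_[p]) : ℚ_[p]) := by
      rw [PadicInt.coe_sub, PadicInt.coe_pow, Units.val_pow_eq_pow_val, PadicInt.coe_pow,
        PadicInt.coe_one, map_sub, map_one, ← pow_mul, map_pow, hb]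
    refine ⟨_, hεU ⟨?_, ?_⟩, hP n⟩
    · rw [mem_ball_zero_iff, hs, norm_algebraMap']
      rwa [PadicInt.norm_def] at hnε
    · intro h0
      rw [Set.mem_singleton_iff, hs, map_eq_zero] at h0
      have h1 : ((α⁻¹ ^ N : ℤ_[p]ˣ) : ℤ_[p]) ^ n - 1 = 0 := PadicInt.ext h0
      have h2 : α⁻¹ ^ (N * n) = 1 := by
        rw [pow_mul]
        exact Units.ext (by simpa using sub_eq_zero.1 h1)
      exact hα (isOfFinOrder_inv_iff.1
        (isOfFinOrder_iff_pow_eq_one.2 ⟨N * n, Nat.mul_pos hN hn, h2⟩))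
  refine ⟨C.ker ⊓ D.ker, M, hM, ?_, ?_, ?_⟩
  · rintro γ ⟨h1, h2⟩
    have h3 : (f (ProfComp.of Γ γ)).toAdd = 0 := by
      rw [hfcd]
      have h1' : (c (ProfComp.of Γ γ)) = 1 := h1
      have h2' : (d (ProfComp.of Γ γ)) = 1 := h2
      rw [h1', h2', toAdd_one, add_zero]
    have h4 := congrArg Subtype.val (hfM _ h3)
    exact Units.ext (by simpa [χE] using h4)
  · have hroot : ∀ (F : Γ →* Multiplicative E) (γ : Γ) (n : ℕ), 0 < n → F (γ ^ n) = 1 → F γ = 1 := by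
      intro F γ n hn h
      rw [map_pow] at h
      have h1 : n • (F γ).toAdd = 0 := by rw [← toAdd_pow, h, toAdd_one]
      rw [nsmul_eq_mul] at h1
      exact (mul_eq_zero.1 h1).resolve_left (Nat.cast_ne_zero.2 hn.ne')
    rintro γ n hn ⟨h1, h2⟩
    exact ⟨hroot C γ n hn h1, hroot D γ n hn h2⟩
  · intro Q hQ γ₀
    have hsum := sum_eq_zero_of_frequently_expSum_eq_zero p Q.coeff.support
      (fun γ => Q.coeff γ * (χ.1 (ProfComp.of Γ γ) : PadicAlgCl p)) (fun γ => (C γ).toAdd)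
      (fun γ => (D γ).toAdd) (hfreq _ fun n => by
        have h1 := (CharVar.mem_point_iff _ _).1 (hI Q hQ (N * n))
        rw [← h1]
        refine Finset.sum_congr rfl fun γ _ => ?_
        rw [mul_assoc, ← horbit]
        congr 2
        exact (ContChar.iterate_comp_apply (σ : ProfComp Γ →ₜ* ProfComp Γ) χ (N * n) _).symm)
      (C γ₀).toAdd (D γ₀).toAdd
    refine Eq.trans (Finset.sum_congr ?_ fun _ _ => rfl) hsum
    ext γ
    simp only [Finset.mem_filter]
    refine and_congr_right fun _ => ?_
    rw [Subgroup.mem_inf, MonoidHom.mem_ker, MonoidHom.mem_ker, map_div, map_div, div_eq_one,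
      div_eq_one]
    exact Iff.rfl

end Orbits

/-! ### Zariski density of metric neighbourhoods -/

section Density

open Polynomial

variable {K : Type*} [NontriviallyNormedField K]

/-- A nonzero polynomial does not vanish on a neighbourhood of a point. -/
lemma MvPolynomial.frequently_eval_ne_zero {s : ℕ} {q : MvPolynomial (Fin s) K} (hq : q ≠ 0)
    (t₀ : Fin s → K) : ∃ᶠ t in 𝓝 t₀, MvPolynomial.eval t q ≠ 0 := by
  intro h
  simp only [ne_eq, not_not] at h
  obtain ⟨r, hr, hb⟩ := Metric.eventually_nhds_iff_ball.1 h
  refine hq (MvPolynomial.funext_set (fun i => Metric.ball (t₀ i) r)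
    (fun i => infinite_of_mem_nhds (t₀ i) (Metric.ball_mem_nhds _ hr)) fun t ht => ?_)
  rw [map_zero]
  refine hb t ?_
  rw [ball_pi _ hr]
  exact ht

/-- A monic polynomial over an algebraically closed field whose constant coefficient is small has a
small root. -/
lemma Polynomial.exists_root_norm_lt [IsAlgClosed K] {Q : K[X]} (hQ : Q.Monic) {δ : ℝ}
    (hδ : 0 < δ) (h0 : ‖Q.coeff 0‖ < δ ^ Q.natDegree) : ∃ c, Q.IsRoot c ∧ ‖c‖ < δ := by
  by_contra! hc
  have hs := IsAlgClosed.splits Q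
  rw [hs.coeff_zero_eq_prod_roots_of_monic hQ, norm_mul, norm_pow, norm_neg, norm_one, one_pow,
    one_mul, hs.natDegree_eq_card_roots] at h0
  refine absurd h0 (not_lt.2 ?_)
  have key : ∀ m : Multiset K, (∀ c ∈ m, δ ≤ ‖c‖) → δ ^ m.card ≤ ‖m.prod‖ := by
    intro m
    induction m using Multiset.induction_on with
    | empty => simp
    | cons a m ih =>
      intro hm
      rw [Multiset.card_cons, Multiset.prod_cons, norm_mul, pow_succ']
      exact mul_le_mul (hm a (Multiset.mem_cons_self _ _))
        (ih fun c hc => hm c (Multiset.mem_cons_of_mem hc)) (by positivity) (norm_nonneg _)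
  exact key _ fun c hcm => hc c ((mem_roots hQ.ne_zero).1 hcm)

/-- For polynomials of degree less than `n`, the coefficients are bounded linearly in terms of the
values at any `n` of the points `0, …, L - 1`. -/
lemma exists_coeff_bound [CharZero K] (n L : ℕ) : ∃ C : ℝ, 0 < C ∧ ∀ (z : Fin n → K) (T : Finset ℕ),
    T ⊆ Finset.range L → n ≤ T.card → ∀ δ : ℝ,
      (∀ a ∈ T, ‖∑ i, z i * (a : K) ^ (i : ℕ)‖ ≤ δ) → ∀ i, ‖z i‖ ≤ C * δ := by
  classical
  let c : Finset ℕ → ℕ → ℕ → ℝ := fun T a i => ‖(Lagrange.basis T (Nat.cast : ℕ → K) a).coeff i‖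
  refine ⟨1 + ∑ T ∈ (Finset.range L).powerset, ∑ i ∈ Finset.range n, ∑ a ∈ T, c T a i,
    by positivity, fun z T hTL hT δ hδ i => ?_⟩
  rcases T.eq_empty_or_nonempty with rfl | ⟨a₀, ha₀⟩
  · exact absurd i.2 (by simp at hT; omega)
  have hδ0 : 0 ≤ δ := (norm_nonneg _).trans (hδ a₀ ha₀)
  let Z : K[X] := ∑ i, C (z i) * X ^ (i : ℕ)
  have hZc : Z.coeff i = z i := by
    simp only [Z, finsetSum_coeff, coeff_C_mul, coeff_X_pow, mul_ite, mul_one, mul_zero]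
    rw [Finset.sum_eq_single i]
    · simp
    · intro j _ hj
      rw [if_neg fun h => hj (Fin.ext h.symm)]
    · simp
  have hZd : Z.degree < T.card := by
    refine (degree_sum_fin_lt z).trans_le ?_
    exact_mod_cast hT
  have hZe : ∀ a : ℕ, Z.eval (a : K) = ∑ i, z i * (a : K) ^ (i : ℕ) := fun a => by
    simp [Z, eval_finsetSum]
  have hint := Lagrange.eq_interpolate (f := Z) (s := T) (v := (Nat.cast : ℕ → K))
    (Nat.cast_injective.injOn) hZd
  have h1 : ‖z i‖ ≤ ∑ a ∈ T, δ * c T a i := by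
    rw [← hZc, hint, Lagrange.interpolate_apply, finsetSum_coeff]
    refine (norm_sum_le _ _).trans (Finset.sum_le_sum fun a ha => ?_)
    rw [coeff_C_mul, norm_mul, hZe]
    exact mul_le_mul_of_nonneg_right (hδ a ha) (norm_nonneg _)
  refine h1.trans ?_
  rw [← Finset.mul_sum, mul_comm δ]
  refine mul_le_mul_of_nonneg_right ?_ hδ0
  have h2 : ∑ a ∈ T, c T a i ≤ ∑ i ∈ Finset.range n, ∑ a ∈ T, c T a i :=
    Finset.single_le_sum (f := fun i => ∑ a ∈ T, c T a i)
      (fun i _ => Finset.sum_nonneg fun a _ => norm_nonneg _) (Finset.mem_range.2 i.2)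
  have h3 : ∑ i ∈ Finset.range n, ∑ a ∈ T, c T a i ≤
      ∑ T ∈ (Finset.range L).powerset, ∑ i ∈ Finset.range n, ∑ a ∈ T, c T a i :=
    Finset.single_le_sum (f := fun T => ∑ i ∈ Finset.range n, ∑ a ∈ T, c T a i)
      (fun T _ => Finset.sum_nonneg fun i _ => Finset.sum_nonneg fun a _ => norm_nonneg _)
      (Finset.mem_powerset.2 hTL)
  linarith

section Fibres

variable [IsAlgClosed K] {s : ℕ} {A : Type*} [CommRing A] [IsDomain A] [Algebra K A]
  [Algebra (MvPolynomial (Fin s) K) A] [IsScalarTower K (MvPolynomial (Fin s) K) A]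
  [Module.Finite (MvPolynomial (Fin s) K) A] [Module.IsTorsionFree (MvPolynomial (Fin s) K) A]

omit [IsAlgClosed K] [IsDomain A] [IsScalarTower K (MvPolynomial (Fin s) K) A]
  [Module.Finite (MvPolynomial (Fin s) K) A] [Module.IsTorsionFree (MvPolynomial (Fin s) K) A] in
/-- Points over `t` send `h` to a root of the minimal polynomial of `h` specialised at `t`. -/
lemma isRoot_minpoly_map {t : Fin s → K} {y : A →ₐ[K] K}
    (hy : ∀ q : MvPolynomial (Fin s) K, y (algebraMap _ A q) = MvPolynomial.eval t q) (h : A) :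
    ((minpoly (MvPolynomial (Fin s) K) h).map (MvPolynomial.eval t)).IsRoot (y h) := by
  have hcomp : (y : A →+* K).comp (algebraMap (MvPolynomial (Fin s) K) A) = MvPolynomial.eval t :=
    RingHom.ext hy
  rw [IsRoot, eval_map, ← hcomp]
  have := Polynomial.hom_eval₂ (minpoly (MvPolynomial (Fin s) K) h)
    (algebraMap (MvPolynomial (Fin s) K) A) (y : A →+* K) h
  rw [← aeval_def, minpoly.aeval, map_zero] at this
  exact this.symm

/-- Every root of the minimal polynomial of `h` specialised at `t` is the value of `h` at a point
over `t`. -/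
lemma exists_point_of_isRoot {t : Fin s → K} {h : A} {c : K}
    (hc : ((minpoly (MvPolynomial (Fin s) K) h).map (MvPolynomial.eval t)).IsRoot c) :
    ∃ y : A →ₐ[K] K,
      (∀ q : MvPolynomial (Fin s) K, y (algebraMap _ A q) = MvPolynomial.eval t q) ∧ y h = c := by
  let P := MvPolynomial (Fin s) K
  let φ : P[X] →+* K := eval₂RingHom (MvPolynomial.eval t) c
  let _ : Algebra P[X] A := (aeval (R := P) h).toRingHom.toAlgebra
  have hmap : ∀ q : P[X], algebraMap P[X] A q = aeval h q := fun _ => rfl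
  have : IsScalarTower P P[X] A := IsScalarTower.of_algebraMap_eq fun q => by
    rw [hmap]; exact (aeval_C h q).symm
  have hint : Algebra.IsIntegral P[X] A := Algebra.IsIntegral.tower_top (R := P)
  have hφC : ∀ k : K, φ (C (MvPolynomial.C k)) = k := fun k => by
    rw [coe_eval₂RingHom, eval₂_C, MvPolynomial.eval_C]
  have hφs : Function.Surjective φ := fun k => ⟨C (MvPolynomial.C k), hφC k⟩
  have hmax : (RingHom.ker φ).IsMaximal := RingHom.ker_isMaximal_of_surjective φ hφs
  have hker : RingHom.ker (algebraMap P[X] A) ≤ RingHom.ker φ := by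
    intro q hq
    obtain ⟨q', rfl⟩ := (minpoly.isIntegrallyClosed_dvd_iff
      (Algebra.IsIntegral.isIntegral (R := P) h) q).1 hq
    rw [RingHom.mem_ker, map_mul]
    have : φ (minpoly P h) = 0 := by
      rwa [IsRoot, eval_map] at hc
    rw [this, zero_mul]
  obtain ⟨Q, hQ, hQφ⟩ := Ideal.exists_ideal_over_maximal_of_isIntegral (RingHom.ker φ) hker
  -- The residue field `A / Q` is `K` by the Nullstellensatz.
  have hft : Algebra.FiniteType K A :=
    Algebra.FiniteType.trans (S := P) inferInstance inferInstance
  let _ : Field (A ⧸ Q) := Ideal.Quotient.field Q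
  have hfin : Module.Finite K (A ⧸ Q) := finite_of_finite_type_of_isJacobsonRing K (A ⧸ Q)
  let e : K ≃ₐ[K] A ⧸ Q := AlgEquiv.ofBijective (Algebra.ofId K (A ⧸ Q))
    IsAlgClosed.algebraMap_bijective_of_isIntegral
  let y : A →ₐ[K] K := e.symm.toAlgHom.comp (Ideal.Quotient.mkₐ K Q)
  have hy : ∀ q : P[X], y (aeval h q) = φ q := by
    intro q
    have h1 : aeval h q - algebraMap K A (φ q) ∈ Q := by
      have h2 : q - C (MvPolynomial.C (φ q)) ∈ RingHom.ker φ := by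
        rw [RingHom.mem_ker, map_sub, hφC, sub_self]
      rw [← hQφ, Ideal.mem_comap, hmap, map_sub, aeval_C] at h2
      rwa [IsScalarTower.algebraMap_apply K P A]
    have h3 : y (aeval h q - algebraMap K A (φ q)) = 0 := by
      change e.symm (Ideal.Quotient.mk Q _) = 0
      rw [Ideal.Quotient.eq_zero_iff_mem.2 h1, map_zero]
    rwa [map_sub, sub_eq_zero, AlgHom.commutes] at h3
  refine ⟨y, fun q => ?_, ?_⟩
  · have := hy (C q)
    rw [aeval_C] at this
    rw [this]
    simp [φ]
  · have := hy X
    rw [aeval_X] at this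
    rw [this]
    simp [φ]

/-- If `h` vanishes at `x`, then over every point near the image of `x` there is a point at which
`h` is small. -/
lemma eventually_exists_point_norm_lt (x : A →ₐ[K] K) {t₀ : Fin s → K}
    (hx : ∀ q : MvPolynomial (Fin s) K, x (algebraMap _ A q) = MvPolynomial.eval t₀ q) {h : A}
    (hh : x h = 0) {δ : ℝ} (hδ : 0 < δ) : ∀ᶠ t in 𝓝 t₀, ∃ y : A →ₐ[K] K,
      (∀ q : MvPolynomial (Fin s) K, y (algebraMap _ A q) = MvPolynomial.eval t q) ∧ ‖y h‖ < δ := by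
  set m := minpoly (MvPolynomial (Fin s) K) h with hm
  have hmonic : m.Monic := minpoly.monic (Algebra.IsIntegral.isIntegral h)
  have h0 : MvPolynomial.eval t₀ (m.coeff 0) = 0 := by
    have := isRoot_minpoly_map hx h
    rwa [hh, IsRoot, ← coeff_zero_eq_eval_zero, coeff_map] at this
  have hcont : Continuous fun t => ‖MvPolynomial.eval t (m.coeff 0)‖ :=
    (MvPolynomial.continuous_eval _).norm
  have hlim := hcont.tendsto t₀
  rw [h0, norm_zero] at hlim
  filter_upwards [hlim.eventually (gt_mem_nhds (pow_pos hδ m.natDegree))] with t ht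
  obtain ⟨c, hc, hcδ⟩ := Polynomial.exists_root_norm_lt (hmonic.map (MvPolynomial.eval t)) hδ (by
    rwa [coeff_map, hmonic.natDegree_map])
  obtain ⟨y, hy, hyc⟩ := exists_point_of_isRoot hc
  exact ⟨y, hy, hyc ▸ hcδ⟩

end Fibres

/-- On an irreducible affine variety over an algebraically closed normed field, every metric
neighbourhood of a point is Zariski dense. -/
theorem exists_point_near_ne_zero [IsAlgClosed K] [CharZero K] {A : Type*} [CommRing A] [IsDomain A]
    [Algebra K A] [Algebra.FiniteType K A] (x : A →ₐ[K] K) {f : A} (hf : f ≠ 0) {n : ℕ}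
    (z : Fin n → A) {ε : ℝ} (hε : 0 < ε) :
    ∃ y : A →ₐ[K] K, y f ≠ 0 ∧ ∀ i, ‖y (z i) - x (z i)‖ < ε := by
  classical
  obtain ⟨s, g, hginj, hgfin⟩ := exists_finite_inj_algHom_of_fg K A
  let P := MvPolynomial (Fin s) K
  let _ : Algebra P A := g.toRingHom.toAlgebra
  have hmap : ∀ q : P, algebraMap P A q = g q := fun _ => rfl
  have : IsScalarTower K P A := IsScalarTower.of_algebraMap_eq fun k => by
    rw [hmap]; exact (g.commutes k).symm
  have hfin : Module.Finite P A := hgfin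
  have : FaithfulSMul P A := (faithfulSMul_iff_algebraMap_injective P A).2 hginj
  have : Module.IsTorsionFree P A := inferInstance
  let t₀ : Fin s → K := fun i => x (g (MvPolynomial.X i))
  have hx : ∀ q : P, x (algebraMap P A q) = MvPolynomial.eval t₀ q := by
    intro q
    have : x.comp g = MvPolynomial.aeval t₀ := MvPolynomial.algHom_ext fun i => by simp [t₀]
    exact DFunLike.congr_fun this q
  -- A nonzero multiple of `f` coming from the polynomial ring.
  obtain ⟨q, hq, hq0⟩ : ∃ q : P, algebraMap P A q ∈ Ideal.span {f} ∧ q ≠ 0 := by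
    have := Ideal.comap_ne_bot_of_integral_mem hf (Ideal.mem_span_singleton_self f)
      (Algebra.IsIntegral.isIntegral (R := P) f)
    exact Submodule.exists_mem_ne_zero_of_ne_bot this
  obtain ⟨f', hf'⟩ := Ideal.mem_span_singleton'.1 hq
  obtain ⟨G, hG⟩ := Module.finite_def.1 hfin
  -- The number of points in a fibre is bounded by `B`.
  let B : ℕ := ∏ e : G, (minpoly P (e : A)).natDegree
  let L : ℕ := B * n + 1
  obtain ⟨C, hC, hCbound⟩ := exists_coeff_bound (K := K) n L
  -- `h a` is the value at `a` of a polynomial whose coefficients `w i` vanish at `x`. Over each point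
  -- near `t₀`, every `h a` is small somewhere on the fibre, so by pigeonhole more than `n` of them are
  -- small at a common point, which makes all the `w i` small there.
  let w : Fin n → A := fun i => z i - algebraMap K A (x (z i))
  let h : ℕ → A := fun a => ∑ i, w i * (a : A) ^ (i : ℕ)
  have hxw : ∀ i, x (w i) = 0 := fun i => by simp [w]
  have hev : ∀ᶠ t in 𝓝 t₀, ∀ a ∈ Finset.range L, ∃ y : A →ₐ[K] K,
      (∀ q : P, y (algebraMap P A q) = MvPolynomial.eval t q) ∧ ‖y (h a)‖ < ε / (2 * C) := by
    refine (Filter.eventually_all_finset _).2 fun a _ => ?_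
    refine eventually_exists_point_norm_lt x hx ?_ (by positivity)
    simp [h, hxw]
  obtain ⟨t, htq, ht⟩ := ((MvPolynomial.frequently_eval_ne_zero hq0 t₀).and_eventually hev).exists
  have : Nonempty (A →ₐ[K] K) := ⟨x⟩
  choose! y hy hyδ using ht
  let v : ℕ → G → K := fun a e => y a e
  let F : Finset (G → K) := Fintype.piFinset fun e : G =>
    ((minpoly P (e : A)).map (MvPolynomial.eval t)).roots.toFinset
  have hvF : ∀ a ∈ Finset.range L, v a ∈ F := by
    intro a ha
    refine Fintype.mem_piFinset.2 fun e => ?_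
    rw [Multiset.mem_toFinset, mem_roots]
    · exact isRoot_minpoly_map (hy a ha) _
    · exact ((minpoly.monic (Algebra.IsIntegral.isIntegral _)).map _).ne_zero
  have hFB : F.card ≤ B := by
    rw [Fintype.card_piFinset]
    refine Finset.prod_le_prod' fun e _ => (Multiset.toFinset_card_le _).trans ?_
    exact (card_roots' _).trans natDegree_map_le
  obtain ⟨u, -, hu⟩ := Finset.exists_lt_card_fiber_of_mul_lt_card_of_maps_to hvF (n := n) (by
    rw [Finset.card_range]
    exact Nat.lt_succ_of_le (Nat.mul_le_mul_right n hFB))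
  set T := (Finset.range L).filter fun a => v a = u with hT
  obtain ⟨a₀, ha₀⟩ : T.Nonempty := Finset.card_pos.1 (Nat.zero_lt_of_lt hu)
  have hTL : ∀ a ∈ T, a ∈ Finset.range L := fun a ha => (Finset.mem_filter.1 ha).1
  -- All the points `y a` with `a ∈ T` coincide, since they agree on module generators.
  have heq : ∀ a ∈ T, ∀ b : A, y a b = y a₀ b := by
    intro a ha b
    have hb : b ∈ Submodule.span P (G : Set A) := hG ▸ Submodule.mem_top
    induction hb using Submodule.span_induction with
    | mem b hb =>
      exact congrFun ((Finset.mem_filter.1 ha).2.trans (Finset.mem_filter.1 ha₀).2.symm) ⟨b, hb⟩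
    | zero => rw [map_zero, map_zero]
    | add b c _ _ hb hc => rw [map_add, map_add, hb, hc]
    | smul r b _ hb =>
      rw [Algebra.smul_def, map_mul, map_mul, hb, hy a (hTL a ha), hy a₀ (hTL a₀ ha₀)]
  refine ⟨y a₀, fun h0 => htq ?_, fun i => ?_⟩
  · rw [← hy a₀ (hTL a₀ ha₀), ← hf', map_mul, h0, mul_zero]
  · have hsmall := hCbound (fun i => y a₀ (w i)) T (Finset.filter_subset _ _) hu.le (ε / (2 * C))
      (fun a ha => by
        have h1 := (hyδ a (hTL a ha)).le
        rw [heq a ha] at h1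
        simpa [h] using h1) i
    have h2 : y a₀ (w i) = y a₀ (z i) - x (z i) := by simp [w]
    rw [← h2]
    refine hsmall.trans_lt ?_
    rw [mul_div_assoc', mul_comm 2 C, mul_div_mul_left _ _ hC.ne']
    linarith

end Density

/-! ### Characters with values of norm one -/

section UnitCharacters

variable {p : ℕ} [Fact p.Prime]

lemma norm_eq_one_of_norm_sub_one_lt {x : PadicAlgCl p} (hx : ‖x - 1‖ < 1 / p) : ‖x‖ = 1 := by
  have hp : (1 : ℝ) / p ≤ 1 := by
    have : (1 : ℝ) ≤ p := by exact_mod_cast (Fact.out : p.Prime).one_le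
    exact (div_le_one (by positivity)).2 this
  have hx1 := hx.trans_le hp
  have h := IsUltrametricDist.norm_add_eq_max_of_norm_ne_norm (x := x - 1) (y := 1) (by
    rw [norm_one]; exact hx1.ne)
  rwa [sub_add_cancel, norm_one, max_eq_right hx1.le] at h

/-- The units at distance less than `1 / p` from `1` form a subgroup. -/
def unitBall (p : ℕ) [Fact p.Prime] : Subgroup (PadicAlgCl p)ˣ where
  carrier := {u | ‖(u : PadicAlgCl p) - 1‖ < 1 / p}
  one_mem' := by
    simpa using (Fact.out : p.Prime).pos
  mul_mem' := by
    intro u v hu hv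
    have h : ((u * v : (PadicAlgCl p)ˣ) : PadicAlgCl p) - 1 = u * (v - 1) + (u - 1) := by
      push_cast
      ring
    rw [Set.mem_ofPred_eq, h]
    refine (IsUltrametricDist.norm_add_le_max _ _).trans_lt (max_lt ?_ hu)
    rwa [norm_mul, norm_eq_one_of_norm_sub_one_lt hu, one_mul]
  inv_mem' := by
    intro u hu
    have h : ((u⁻¹ : (PadicAlgCl p)ˣ) : PadicAlgCl p) - 1 = -((u⁻¹ : (PadicAlgCl p)ˣ) * (u - 1)) := by
      rw [mul_sub, Units.inv_mul]
      ring
    rw [Set.mem_ofPred_eq, h, norm_neg, norm_mul, Units.val_inv_eq_inv_val, norm_inv,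
      norm_eq_one_of_norm_sub_one_lt hu, inv_one, one_mul]
    exact hu

/-- There is no torsion within distance less than `1 / p` of `1`. -/
lemma eq_one_of_mem_unitBall {u : (PadicAlgCl p)ˣ} (hu : u ∈ unitBall p) (h : IsOfFinOrder u) :
    u = 1 := by
  by_contra hne
  obtain ⟨ℓ, hℓ, k, hk⟩ := Nat.exists_prime_and_dvd (mt orderOf_eq_one_iff.1 hne)
  have hk0 : k ≠ 0 := by
    rintro rfl
    exact h.orderOf_pos.ne' hk
  set v := u ^ k with hv
  have hvo : orderOf v = ℓ := by
    rw [hv, orderOf_pow_of_dvd hk0 (hk ▸ dvd_mul_left _ _), hk, Nat.mul_div_cancel _ (Nat.pos_of_ne_zero hk0)]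
  have hvm : v ∈ unitBall p := (unitBall p).pow_mem hu k
  have hv1 : (v : PadicAlgCl p) ≠ 1 := by
    intro h1
    have : v = 1 := Units.ext h1
    rw [this, orderOf_one] at hvo
    exact hℓ.one_lt.ne hvo
  have hgeom : ∑ i ∈ Finset.range ℓ, (v : PadicAlgCl p) ^ i = 0 := by
    have h1 := geom_sum_mul (v : PadicAlgCl p) ℓ
    rw [← Units.val_pow_eq_pow_val, ← hvo, pow_orderOf_eq_one, Units.val_one, sub_self, hvo] at h1
    exact (mul_eq_zero.1 h1).resolve_right (sub_ne_zero.2 hv1)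
  -- Hence `ℓ` is a sum of terms of norm less than `1 / p`.
  have hsum : (ℓ : PadicAlgCl p) = -∑ i ∈ Finset.range ℓ, ((v : PadicAlgCl p) ^ i - 1) := by
    rw [Finset.sum_sub_distrib, hgeom]
    simp
  have hlt : ‖(ℓ : PadicAlgCl p)‖ < 1 / p := by
    rw [hsum, norm_neg]
    have hne : (Finset.range ℓ).Nonempty := Finset.nonempty_range_iff.2 hℓ.ne_zero
    obtain ⟨i, -, hi⟩ := IsUltrametricDist.exists_norm_finsetSum_le_of_nonempty hne
      (fun i => (v : PadicAlgCl p) ^ i - 1)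
    refine hi.trans_lt ?_
    have := (unitBall p).pow_mem hvm i
    simpa [unitBall] using! this
  refine absurd hlt (not_lt.2 ?_)
  rw [norm_natCast_eq_padic (p := p)]
  by_cases hlp : ℓ = p
  · rw [hlp, Padic.norm_p, one_div]
  · have hp : (1 : ℝ) ≤ p := by exact_mod_cast (Fact.out : p.Prime).one_le
    rw [Padic.norm_natCast_eq_one_iff.2 ((Nat.coprime_primes (Fact.out : p.Prime) hℓ).2 (Ne.symm hlp))]
    exact (div_le_one (by positivity)).2 hp

/-- Continuous characters of a compact group have values of norm one. -/
lemma ContChar.norm_eq_one {π : Type*} [CommGroup π] [TopologicalSpace π] [CompactSpace π]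
    (χ : ContChar p π) (g : π) : ‖(χ.1 g : PadicAlgCl p)‖ = 1 := by
  have hc : Continuous fun g => (χ.1 g : PadicAlgCl p) :=
    Units.continuous_val.comp χ.1.continuous_toFun
  obtain ⟨C, hC⟩ := (isCompact_range hc).isBounded.exists_norm_le
  have hle : ∀ g, ‖(χ.1 g : PadicAlgCl p)‖ ≤ 1 := by
    intro g
    by_contra! h
    obtain ⟨n, hn⟩ := pow_unbounded_of_one_lt C h
    have := hC _ ⟨g ^ n, rfl⟩
    simp only [map_pow, Units.val_pow_eq_pow_val, norm_pow] at this
    exact absurd hn (not_lt.2 this)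
  refine le_antisymm (hle g) ?_
  have h1 := hle g⁻¹
  rw [map_inv, Units.val_inv_eq_inv_val, norm_inv] at h1
  exact (inv_le_one₀ (norm_pos_iff.2 (Units.ne_zero _))).1 h1

/-- Every character of a finitely generated abelian group with values of norm one extends to a
continuous character of the profinite completion. -/
theorem exists_contChar_extension {Γ : Type u} [CommGroup Γ] [Group.FG Γ] (y : Γ →* (PadicAlgCl p)ˣ)
    (hy : ∀ γ, ‖(y γ : PadicAlgCl p)‖ = 1) :
    ∃ χ : ContChar p (ProfComp Γ), ∀ γ, χ.1 (ProfComp.of Γ γ) = y γ := by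
  obtain ⟨T, hT⟩ := Group.fg_def.1 (inferInstance : Group.FG Γ)
  let E : IntermediateField ℚ_[p] (PadicAlgCl p) :=
    IntermediateField.adjoin ℚ_[p] ((fun γ => (y γ : PadicAlgCl p)) '' T)
  have hE : FiniteDimensional ℚ_[p] E := by
    have : Finite ((fun γ => (y γ : PadicAlgCl p)) '' T) := (T.finite_toSet.image _).to_subtype
    exact IntermediateField.finiteDimensional_adjoin fun x _ => Algebra.IsIntegral.isIntegral x
  have hyE : ∀ γ, (y γ : PadicAlgCl p) ∈ E := by
    intro γ
    have hγ : γ ∈ Subgroup.closure (T : Set Γ) := hT ▸ Subgroup.mem_top γ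
    induction hγ using Subgroup.closure_induction with
    | mem γ h => exact IntermediateField.subset_adjoin _ _ ⟨γ, h, rfl⟩
    | one => rw [map_one]; exact E.one_mem
    | mul a b _ _ ha hb => rw [map_mul]; exact E.mul_mem ha hb
    | inv a _ ha => rw [map_inv, Units.val_inv_eq_inv_val]; exact E.inv_mem ha
  have hproper : ProperSpace E := FiniteDimensional.proper ℚ_[p] E
  -- The unit sphere of `E` is a profinite group.
  let U := ULift.{u} (Metric.sphere (0 : E) 1)
  have : TotallyDisconnectedSpace U := Homeomorph.ulift.symm.totallyDisconnectedSpace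
  let yU : Γ →* U :=
    { toFun := fun γ => ⟨⟨⟨y γ, hyE γ⟩, by rw [mem_sphere_zero_iff_norm]; exact hy γ⟩⟩
      map_one' := by ext; simp
      map_mul' := fun a b => by
        ext
        exact congrArg Units.val (map_mul y a b) }
  let F : ProfiniteGrp.ProfiniteCompletion.completion (GrpCat.of Γ) ⟶ ProfiniteGrp.of U :=
    ProfiniteGrp.ProfiniteCompletion.lift (GrpCat.ofHom yU)
  have hF : ∀ γ, F.hom (ProfComp.of Γ γ) = yU γ := fun γ =>
    CategoryTheory.ConcreteCategory.congr_hom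
      (ProfiniteGrp.ProfiniteCompletion.lift_eta (P := ProfiniteGrp.of U) (GrpCat.ofHom yU)) γ
  let toUnits : U →* (PadicAlgCl p)ˣ := (Units.map (algebraMap E (PadicAlgCl p)).toMonoidHom).comp
    ((unitSphereToUnits E).comp MulEquiv.ulift.toMonoidHom)
  have hval : ∀ u : U, (toUnits u : PadicAlgCl p) = ((u.down : E) : PadicAlgCl p) := fun _ => rfl
  have hcont : Continuous toUnits := by
    refine Units.isEmbedding_val₀.continuous_iff.2 ?_
    exact continuous_subtype_val.comp (continuous_subtype_val.comp continuous_uliftDown)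
  let χ : ProfComp Γ →ₜ* (PadicAlgCl p)ˣ :=
    { toMonoidHom := toUnits.comp F.hom.toMonoidHom
      continuous_toFun := hcont.comp F.hom.continuous_toFun }
  refine ⟨⟨χ, E, hE, fun g => (F.hom g).down.1.2⟩, fun γ => Units.ext ?_⟩
  change (toUnits (F.hom (ProfComp.of Γ γ)) : PadicAlgCl p) = _
  rw [hF]
  rfl

end UnitCharacters

/-! ### Saturated subgroups and extension of characters -/

section Saturation

variable {Γ : Type*} [CommGroup Γ]

/-- The saturation of a subgroup: the elements with a nontrivial power in the subgroup. -/
def Subgroup.saturation (H : Subgroup Γ) : Subgroup Γ where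
  carrier := {γ | ∃ n : ℕ, 0 < n ∧ γ ^ n ∈ H}
  one_mem' := ⟨1, one_pos, by simp [H.one_mem]⟩
  mul_mem' := by
    rintro a b ⟨m, hm, ha⟩ ⟨n, hn, hb⟩
    refine ⟨m * n, Nat.mul_pos hm hn, ?_⟩
    rw [mul_pow, pow_mul, mul_comm m n, pow_mul]
    exact H.mul_mem (H.pow_mem ha n) (H.pow_mem hb m)
  inv_mem' := by
    rintro a ⟨m, hm, ha⟩
    exact ⟨m, hm, by rw [inv_pow]; exact H.inv_mem ha⟩

lemma Subgroup.le_saturation (H : Subgroup Γ) : H ≤ H.saturation := fun γ hγ =>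
  ⟨1, one_pos, by rwa [pow_one]⟩

lemma isMulTorsionFree_quotient {N : Subgroup Γ} (hN : ∀ (γ : Γ) (n : ℕ), 0 < n → γ ^ n ∈ N → γ ∈ N) :
    IsMulTorsionFree (Γ ⧸ N) := by
  refine ⟨fun n hn a b hab => ?_⟩
  obtain ⟨a, rfl⟩ := QuotientGroup.mk_surjective a
  obtain ⟨b, rfl⟩ := QuotientGroup.mk_surjective b
  have h : (QuotientGroup.mk (a ^ n) : Γ ⧸ N) = QuotientGroup.mk (b ^ n) := hab
  rw [QuotientGroup.eq, ← inv_pow, ← mul_pow] at h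
  exact QuotientGroup.eq.2 (hN _ n (Nat.pos_of_ne_zero hn) h)

lemma Subgroup.mem_saturation_of_pow_mem (H : Subgroup Γ) (γ : Γ) (n : ℕ) (hn : 0 < n)
    (h : γ ^ n ∈ H.saturation) : γ ∈ H.saturation := by
  obtain ⟨m, hm, h⟩ := h
  exact ⟨n * m, Nat.mul_pos hn hm, by rwa [pow_mul]⟩

/-- A character of finite order on a subgroup with torsion-free quotient extends to a character of
finite order on the whole group, because the subgroup is a direct factor. -/
theorem exists_isOfFinOrder_extension [Group.FG Γ] {G : Type*} [CommGroup G] (N : Subgroup Γ)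
    [IsMulTorsionFree (Γ ⧸ N)] (y : Γ →* G) {M : ℕ} (hM : 0 < M) (hy : ∀ γ ∈ N, y γ ^ M = 1) :
    ∃ χ : Γ →* G, IsOfFinOrder χ ∧ ∀ γ ∈ N, χ γ = y γ := by
  have hfin : Module.Finite ℤ (Additive (Γ ⧸ N)) := by
    have : AddGroup.FG (Additive (Γ ⧸ N)) := inferInstance
    exact Module.Finite.iff_addGroup_fg.2 this
  have hfree : Module.Free ℤ (Additive (Γ ⧸ N)) := inferInstance
  obtain ⟨s, hs⟩ := Module.projective_lifting_property
    (QuotientGroup.mk' N).toAdditive.toIntLinearMap (LinearMap.id (R := ℤ) (M := Additive (Γ ⧸ N)))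
    (QuotientGroup.mk'_surjective N)
  let s' : Γ ⧸ N →* Γ := MonoidHom.toAdditive.symm s.toAddMonoidHom
  have hs' : ∀ x, (QuotientGroup.mk (s' x) : Γ ⧸ N) = x := fun x =>
    LinearMap.congr_fun hs (Additive.ofMul x)
  -- The projection onto `N` along the splitting `s'`.
  let r : Γ →* Γ := MonoidHom.id Γ / s'.comp (QuotientGroup.mk' N)
  have hr : ∀ γ, r γ ∈ N := by
    intro γ
    change γ / s' (QuotientGroup.mk γ) ∈ N
    rw [← QuotientGroup.eq_one_iff, QuotientGroup.mk_div, hs', div_self']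
  refine ⟨y.comp r, isOfFinOrder_iff_pow_eq_one.2 ⟨M, hM, MonoidHom.ext fun γ => hy _ (hr γ)⟩,
    fun γ hγ => ?_⟩
  change y (γ / s' (QuotientGroup.mk γ)) = y γ
  rw [(QuotientGroup.eq_one_iff γ).2 hγ, map_one, div_one]

end Saturation

/-! ### Cosets of subtori -/

section TorusCosets

variable {K : Type*} [Field K] {Γ : Type*} [CommGroup Γ]

/-- Restriction of functions to the coset of `χ` under the torus `Spec K[Γ/N]`, identified with
that torus through translation by `χ`. -/
def CharVar.restrict (χ : Γ →* Kˣ) (N : Subgroup Γ) : MonoidAlgebra K Γ →+* MonoidAlgebra K (Γ ⧸ N) :=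
  (MonoidAlgebra.mapDomainRingHom K (QuotientGroup.mk' N)).comp (CharVar.twist χ).toRingHom

lemma CharVar.restrict_single (χ : Γ →* Kˣ) (N : Subgroup Γ) (γ : Γ) (a : K) :
    CharVar.restrict χ N (MonoidAlgebra.single γ a) =
      MonoidAlgebra.single (QuotientGroup.mk γ) (a * χ γ) := by
  simp [CharVar.restrict, CharVar.twist, MonoidAlgebra.lift_single]

lemma CharVar.restrict_surjective (χ : Γ →* Kˣ) (N : Subgroup Γ) :
    Function.Surjective (CharVar.restrict χ N) := by
  intro Q
  induction Q using MonoidAlgebra.induction_linear with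
  | zero => exact ⟨0, map_zero _⟩
  | add P Q hP hQ =>
    obtain ⟨P, rfl⟩ := hP
    obtain ⟨Q, rfl⟩ := hQ
    exact ⟨P + Q, map_add _ _ _⟩
  | single x a =>
    obtain ⟨γ, rfl⟩ := QuotientGroup.mk_surjective x
    refine ⟨MonoidAlgebra.single γ (a * ((χ γ)⁻¹ : Kˣ)), ?_⟩
    rw [CharVar.restrict_single, mul_assoc, Units.inv_mul, mul_one]

lemma CharVar.translate_image_ofQuotient (χ : Γ →* Kˣ) (N : Subgroup Γ) :
    CharVar.translate χ '' CharVar.ofQuotient K N =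
      PrimeSpectrum.zeroLocus (RingHom.ker (CharVar.restrict χ N)) := by
  rw [← range_comap_of_surjective _ _ (CharVar.restrict_surjective χ N),
    CharVar.ofQuotient, ← Set.range_comp]
  rfl

/-- A function whose coefficients, weighted by `χ`, sum to zero over each coset of `N` vanishes on
the coset of `χ` under the torus `Spec K[Γ/N]`. -/
lemma CharVar.mem_ker_restrict (χ : Γ →* Kˣ) (N : Subgroup Γ) (Q : MonoidAlgebra K Γ)
    (hQ : ∀ γ₀ : Γ, letI := Classical.decPred (· ∈ N)
      ∑ γ ∈ Q.coeff.support with γ / γ₀ ∈ N, Q.coeff γ * (χ γ : K) = 0) :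
    Q ∈ RingHom.ker (CharVar.restrict χ N) := by
  classical
  rw [RingHom.mem_ker]
  have hsum : CharVar.restrict χ N Q = ∑ γ ∈ Q.coeff.support,
      MonoidAlgebra.single (QuotientGroup.mk γ : Γ ⧸ N) (Q.coeff γ * (χ γ : K)) := by
    conv_lhs => rw [← MonoidAlgebra.sum_coeff_single Q]
    rw [Finsupp.sum, map_sum]
    exact Finset.sum_congr rfl fun γ _ => CharVar.restrict_single _ _ _ _
  ext x
  obtain ⟨γ₀, rfl⟩ := QuotientGroup.mk_surjective x
  rw [hsum]
  have h0 := hQ γ₀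
  rw [Finset.sum_filter] at h0
  simp only [MonoidAlgebra.coeff_sum, MonoidAlgebra.coeff_single, Finsupp.finsetSum_apply,
    Finsupp.single_apply, MonoidAlgebra.coeff_zero, Finsupp.zero_apply]
  refine Eq.trans ?_ h0
  refine Finset.sum_congr rfl fun γ _ => ?_
  have : (QuotientGroup.mk γ : Γ ⧸ N) = QuotientGroup.mk γ₀ ↔ γ / γ₀ ∈ N := by
    rw [eq_comm, QuotientGroup.eq, mul_comm, div_eq_mul_inv]
  simp only [this]

/-- The coset of `χ` under `Spec K[Γ/N]` is cut out by the functions `γ - χ γ` for `γ ∈ N`. -/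
lemma CharVar.ker_restrict_le (χ : Γ →* Kˣ) (N : Subgroup Γ) (P : Ideal (MonoidAlgebra K Γ))
    (hP : ∀ γ ∈ N, MonoidAlgebra.single γ 1 - algebraMap K _ (χ γ : K) ∈ P) :
    RingHom.ker (CharVar.restrict χ N) ≤ P := by
  -- The quotient map by `P` factors through the restriction to the coset.
  let ρ : Γ →* MonoidAlgebra K Γ ⧸ P :=
    { toFun := fun γ => Ideal.Quotient.mk P (MonoidAlgebra.single γ ((χ γ)⁻¹ : Kˣ))
      map_one' := by
        rw [map_one, inv_one, Units.val_one, ← MonoidAlgebra.one_def, map_one]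
      map_mul' := fun a b => by
        rw [← map_mul, MonoidAlgebra.single_mul_single, map_mul, mul_inv, Units.val_mul] }
  have hρ : N ≤ ρ.ker := by
    intro γ hγ
    change Ideal.Quotient.mk P (MonoidAlgebra.single γ (((χ γ)⁻¹ : Kˣ) : K)) = 1
    rw [← map_one (Ideal.Quotient.mk P), Ideal.Quotient.mk_eq_mk_iff_sub_mem]
    have h := P.mul_mem_left (algebraMap K _ (((χ γ)⁻¹ : Kˣ) : K)) (hP γ hγ)
    convert h using 1
    rw [mul_sub, ← map_mul, Units.inv_mul, map_one]
    simp [MonoidAlgebra.single_mul_single]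
  let ψ : MonoidAlgebra K (Γ ⧸ N) →ₐ[K] MonoidAlgebra K Γ ⧸ P :=
    MonoidAlgebra.lift K _ _ (QuotientGroup.lift N ρ hρ)
  have hψ : ∀ Q, ψ (CharVar.restrict χ N Q) = Ideal.Quotient.mk P Q := by
    intro Q
    induction Q using MonoidAlgebra.induction_linear with
    | zero => simp
    | add P Q hP hQ => rw [map_add, map_add, hP, hQ, map_add]
    | single γ a =>
      rw [CharVar.restrict_single, MonoidAlgebra.lift_single]
      change (a * (χ γ : K)) • Ideal.Quotient.mk P (MonoidAlgebra.single γ (((χ γ)⁻¹ : Kˣ) : K)) = _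
      have hsmul : ∀ (k : K) (x : MonoidAlgebra K Γ),
        k • Ideal.Quotient.mk P x = Ideal.Quotient.mk P (k • x) := fun _ _ => rfl
      rw [hsmul, MonoidAlgebra.smul_single, smul_eq_mul, mul_assoc, Units.mul_inv, mul_one]
  intro Q hQ
  rw [← Ideal.Quotient.eq_zero_iff_mem, ← hψ, hQ, map_zero]

/-- An irreducible component of a closed set `S` is the zero locus of a prime which is minimal among
the primes lying in `S`. -/
lemma exists_prime_of_mem_irreducibleComponents {R : Type*} [CommRing R]
    {S : Set (PrimeSpectrum R)} (hS : IsClosed S) {S' : Set S} (hS' : S' ∈ irreducibleComponents S) :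
    ∃ P : PrimeSpectrum R, P ∈ S ∧ Subtype.val '' S' = PrimeSpectrum.zeroLocus (P.asIdeal : Set R) ∧
      ∀ J : PrimeSpectrum R, J ∈ S → J.asIdeal ≤ P.asIdeal → J = P := by
  have hirr : IsIrreducible S' := hS'.1
  have hcl : IsClosed (Subtype.val '' S') :=
    hS.isClosedEmbedding_subtypeVal.isClosedMap _ (isClosed_of_mem_irreducibleComponents _ hS')
  have hirr' : IsIrreducible (Subtype.val '' S') := hirr.image _ continuous_subtype_val.continuousOn
  obtain ⟨P, hP⟩ := QuasiSober.sober hirr' hcl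
  have hPS : P ∈ S := by
    obtain ⟨x, -, hx⟩ : P ∈ Subtype.val '' S' := hP.mem
    exact hx ▸ x.2
  have hPz : Subtype.val '' S' = PrimeSpectrum.zeroLocus (P.asIdeal : Set R) := by
    rw [← PrimeSpectrum.closure_singleton]
    exact hP.symm
  refine ⟨P, hPS, hPz, fun J hJ hJP => ?_⟩
  have hle : S' ⊆ closure {(⟨J, hJ⟩ : S)} := by
    intro x hx
    rw [closure_subtype, Set.image_singleton, PrimeSpectrum.closure_singleton]
    have : x.1 ∈ PrimeSpectrum.zeroLocus (P.asIdeal : Set R) := hPz ▸ ⟨x, hx, rfl⟩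
    exact PrimeSpectrum.zeroLocus_anti_mono hJP this
  have hJS' : (⟨J, hJ⟩ : S) ∈ S' := hS'.2 isIrreducible_singleton.closure hle (subset_closure rfl)
  have : J ∈ PrimeSpectrum.zeroLocus (P.asIdeal : Set R) := hPz ▸ ⟨_, hJS', rfl⟩
  exact PrimeSpectrum.ext (le_antisymm hJP this)

end TorusCosets

/-! ### Finitely many families of torsion cosets -/

section TorsionCosets

variable {K : Type*} [Field K] {Γ : Type*} [CommGroup Γ]

/-- The saturated subgroup generated by the quotients `γ / γ'` over the pairs `(γ, γ')` in `B`. -/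
def quotientSaturation (B : Finset (Γ × Γ)) : Subgroup Γ :=
  (Subgroup.closure ((fun b : Γ × Γ => b.1 / b.2) '' (B : Set (Γ × Γ)))).saturation

/-- The functions in `G` vanish on the coset of the character `y` under the torus `Spec K[Γ/N]`,
and `y` has finite order on `N`, so that this coset contains a torsion character. -/
def LiesOnTorsionCoset (G : Finset (MonoidAlgebra K Γ)) (y : Γ →* Kˣ) (N : Subgroup Γ) : Prop :=
  (∃ M : ℕ, 0 < M ∧ ∀ γ ∈ N, y γ ^ M = 1) ∧ ∀ Q ∈ G, ∀ γ₀ : Γ,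
    letI := Classical.decPred (· ∈ N)
    ∑ γ ∈ Q.coeff.support with γ / γ₀ ∈ N, Q.coeff γ * (y γ : K) = 0

/-- Whether functions with support in `A` vanish on a torus coset depends only on the partition of
`A` by the cosets of `N`, so that `N` may be taken from a finite list. -/
lemma LiesOnTorsionCoset.exists_quotientSaturation {G : Finset (MonoidAlgebra K Γ)} {A : Finset Γ}
    (hA : ∀ Q ∈ G, Q.coeff.support ⊆ A) {y : Γ →* Kˣ} {N : Subgroup Γ}
    (hN : ∀ (γ : Γ) (n : ℕ), 0 < n → γ ^ n ∈ N → γ ∈ N) (h : LiesOnTorsionCoset G y N) :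
    ∃ B ∈ (A ×ˢ A).powerset, LiesOnTorsionCoset G y (quotientSaturation B) := by
  classical
  obtain ⟨⟨M, hM, hyM⟩, hQ⟩ := h
  let B : Finset (Γ × Γ) := (A ×ˢ A).filter fun b => b.1 / b.2 ∈ N
  have hle : quotientSaturation B ≤ N := by
    rintro γ ⟨n, hn, hγ⟩
    refine hN γ n hn ((Subgroup.closure_le N).2 ?_ hγ)
    rintro _ ⟨b, hb, rfl⟩
    exact (Finset.mem_filter.1 hb).2
  have hiff : ∀ γ ∈ A, ∀ γ' ∈ A, (γ / γ' ∈ quotientSaturation B ↔ γ / γ' ∈ N) := fun γ hγ γ' hγ' =>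
    ⟨fun h => hle h, fun h => Subgroup.le_saturation _ (Subgroup.subset_closure
      ⟨(γ, γ'), Finset.mem_filter.2 ⟨Finset.mem_product.2 ⟨hγ, hγ'⟩, h⟩, rfl⟩)⟩
  refine ⟨B, Finset.mem_powerset.2 (Finset.filter_subset _ _),
    ⟨M, hM, fun γ hγ => hyM γ (hle hγ)⟩, fun Q hQG γ₀ => ?_⟩
  by_cases hex : ∃ γ₁ ∈ Q.coeff.support, γ₁ / γ₀ ∈ quotientSaturation B
  · obtain ⟨γ₁, hγ₁, hγ₁₀⟩ := hex
    rw [← hQ Q hQG γ₁]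
    refine Finset.sum_congr (Finset.ext fun γ => ?_) fun _ _ => rfl
    simp only [Finset.mem_filter]
    refine and_congr_right fun hγ => ?_
    rw [← hiff γ (hA Q hQG hγ) γ₁ (hA Q hQG hγ₁), ← div_mul_div_cancel γ γ₁ γ₀]
    exact Subgroup.mul_mem_cancel_right _ hγ₁₀
  · push Not at hex
    rw [Finset.filter_false_of_mem hex, Finset.sum_empty]

end TorsionCosets

end

theorem theorem5p2 {p : ℕ} [Fact p.Prime]
    {Γ : Type u} [CommGroup Γ] [Group.FG Γ] (Γn : Subgroup Γ)
    (σ : ProfComp Γ ≃ₜ* ProfComp Γ)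
    (α : ℤ_[p]ˣ) (hα : ¬ IsOfFinOrder α)
    (hss : Module.End.IsSemisimple (RatProP.map p (σ : ProfComp Γ →ₜ* ProfComp Γ)))
    (hsub : ∀ v : RatProP p (ProfComp Γn),
      RatProP.map p (σ : ProfComp Γ →ₜ* ProfComp Γ)
          (RatProP.map p (ProfComp.map Γn.subtype) v) =
        (((α⁻¹ ^ 2 : ℤ_[p]ˣ) : ℤ_[p]) : ℚ_[p]) • RatProP.map p (ProfComp.map Γn.subtype) v)
    (hquot : ∀ v : RatProP p (ProfComp Γ),
      RatProP.map p (quotientHom (ProfComp.map Γn.subtype).toMonoidHom.range)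
          (RatProP.map p (σ : ProfComp Γ →ₜ* ProfComp Γ) v) =
        (((α⁻¹ : ℤ_[p]ˣ) : ℤ_[p]) : ℚ_[p]) •
          RatProP.map p (quotientHom (ProfComp.map Γn.subtype).toMonoidHom.range) v)
    (S : Set (CharVar (PadicAlgCl p) Γ)) (hS : IsClosed S)
    (hσS : Set.MapsTo
      (fun χ : ContChar p (ProfComp Γ) => χ.comp (σ : ProfComp Γ →ₜ* ProfComp Γ))
      (ContChar.phi ⁻¹' S) (ContChar.phi ⁻¹' S)) :
    ∀ S' ∈ irreducibleComponents S,
      (ContChar.phi ⁻¹' (Subtype.val '' S') : Set (ContChar p (ProfComp Γ))).Nonempty →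
      ∃ (T : Set (CharVar (PadicAlgCl p) Γ)) (χ : Γ →* (PadicAlgCl p)ˣ),
        CharVar.IsSubtorus T ∧ IsOfFinOrder χ ∧
          Subtype.val '' S' = CharVar.translate χ '' T := by
  classical
  rintro S' hS' ⟨x, hx⟩
  obtain ⟨P, hPS, hPz, hPmin⟩ := exists_prime_of_mem_irreducibleComponents hS hS'
  have hPx : P.asIdeal ≤ (ContChar.phi x).asIdeal := by
    have h : ContChar.phi x ∈ PrimeSpectrum.zeroLocus (P.asIdeal : Set _) := hPz ▸ hx
    exact h
  have hzS : ∀ z : CharVar (PadicAlgCl p) Γ, P.asIdeal ≤ z.asIdeal → z ∈ S := fun z hz => by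
    have h : z ∈ Subtype.val '' S' := by rw [hPz]; exact hz
    obtain ⟨w, -, rfl⟩ := h
    exact w.2
  have hft : Algebra.FiniteType (PadicAlgCl p) (MonoidAlgebra (PadicAlgCl p) Γ) := inferInstance
  have hnoeth : IsNoetherianRing (MonoidAlgebra (PadicAlgCl p) Γ) :=
    Algebra.FiniteType.isNoetherianRing (PadicAlgCl p) _
  -- Finitely many equations for `S`, all supported in the finite set `A`.
  obtain ⟨G, hG⟩ := (isNoetherianRing_iff_ideal_fg _).1 hnoeth (PrimeSpectrum.vanishingIdeal S)
  have hGS : ∀ z : CharVar (PadicAlgCl p) Γ, (∀ Q ∈ G, Q ∈ z.asIdeal) ↔ z ∈ S := by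
    intro z
    rw [← hS.closure_eq, ← PrimeSpectrum.zeroLocus_vanishingIdeal_eq_closure, ← hG,
      PrimeSpectrum.zeroLocus_span]
    exact Iff.rfl
  let A : Finset Γ := G.biUnion fun Q => Q.coeff.support
  have hA : ∀ Q ∈ G, Q.coeff.support ⊆ A := fun Q hQ =>
    Finset.subset_biUnion_of_mem (fun Q : MonoidAlgebra (PadicAlgCl p) Γ => Q.coeff.support) hQ
  have hcoset : ∀ χ : ContChar p (ProfComp Γ), ContChar.phi χ ∈ S → ∃ B ∈ (A ×ˢ A).powerset,
      LiesOnTorsionCoset G ((χ.1 : ProfComp Γ →* (PadicAlgCl p)ˣ).comp (ProfComp.of Γ))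
        (quotientSaturation B) := by
    intro χ hχ
    obtain ⟨N₀, M, hM, htors, hsat, hsum⟩ := exists_subgroup_of_orbit Γn σ α hα hsub hquot
      (G : Set (MonoidAlgebra (PadicAlgCl p) Γ)) χ fun Q hQ n =>
        (hGS _).2 ((hσS.iterate n) hχ) Q hQ
    exact LiesOnTorsionCoset.exists_quotientSaturation hA hsat ⟨⟨M, hM, htors⟩, hsum⟩
  -- The points of `S'` near `x`, as algebra homomorphisms.
  let R := MonoidAlgebra (PadicAlgCl p) Γ ⧸ P.asIdeal
  let char : (R →ₐ[PadicAlgCl p] PadicAlgCl p) → Γ →* (PadicAlgCl p)ˣ := fun y =>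
    (((y : R →* PadicAlgCl p).comp (Ideal.Quotient.mk P.asIdeal : _ →* R)).comp
      (MonoidAlgebra.of (PadicAlgCl p) Γ)).toHomUnits
  have hchar : ∀ (y : R →ₐ[PadicAlgCl p] PadicAlgCl p) (γ : Γ), (char y γ : PadicAlgCl p) =
      y (Ideal.Quotient.mk P.asIdeal (MonoidAlgebra.single γ 1)) := fun _ _ => rfl
  have hcharP : ∀ y, P.asIdeal ≤ (CharVar.point (char y)).asIdeal := by
    intro y Q hQ
    have h : MonoidAlgebra.lift (PadicAlgCl p) (PadicAlgCl p) Γ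
        ((Units.coeHom (PadicAlgCl p)).comp (char y)) =
        y.comp (Ideal.Quotient.mkₐ (PadicAlgCl p) P.asIdeal) := by
      rw [MonoidAlgebra.lift_unique' (y.comp (Ideal.Quotient.mkₐ (PadicAlgCl p) P.asIdeal))]
      exact congrArg _ (MonoidHom.ext fun γ => hchar y γ)
    change MonoidAlgebra.lift (PadicAlgCl p) (PadicAlgCl p) Γ
        ((Units.coeHom (PadicAlgCl p)).comp (char y)) Q = 0
    rw [h]
    change y (Ideal.Quotient.mk P.asIdeal Q) = 0
    rw [Ideal.Quotient.eq_zero_iff_mem.2 hQ, map_zero]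
  let x₀ : R →ₐ[PadicAlgCl p] PadicAlgCl p := Ideal.Quotient.liftₐ P.asIdeal
    (MonoidAlgebra.lift (PadicAlgCl p) (PadicAlgCl p) Γ ((Units.coeHom (PadicAlgCl p)).comp
      ((x.1 : ProfComp Γ →* (PadicAlgCl p)ˣ).comp (ProfComp.of Γ)))) fun Q hQ => hPx hQ
  have hx₀ : ∀ γ, (x₀ (Ideal.Quotient.mk P.asIdeal (MonoidAlgebra.single γ 1))) =
      (x.1 (ProfComp.of Γ γ) : PadicAlgCl p) := by
    intro γ
    change MonoidAlgebra.lift (PadicAlgCl p) (PadicAlgCl p) Γ _ (MonoidAlgebra.single γ 1) = _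
    rw [MonoidAlgebra.lift_single, one_smul]
    rfl
  have hx₀char : ∀ γ, char x₀ γ = x.1 (ProfComp.of Γ γ) := fun γ => Units.ext (hx₀ γ)
  let near : (R →ₐ[PadicAlgCl p] PadicAlgCl p) → Prop := fun y =>
    ∀ γ, char y γ / char x₀ γ ∈ unitBall p
  have hdense : ∀ f : R, f ≠ 0 → ∃ y, near y ∧ y f ≠ 0 := by
    intro f hf
    obtain ⟨T, hT⟩ := Group.fg_def.1 (inferInstance : Group.FG Γ)
    have hp : (0 : ℝ) < 1 / p := one_div_pos.2 (by exact_mod_cast (Fact.out : p.Prime).pos)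
    have hRft : Algebra.FiniteType (PadicAlgCl p) R := inferInstance
    obtain ⟨y, hyf, hy⟩ := exists_point_near_ne_zero x₀ hf
      (fun i => Ideal.Quotient.mk P.asIdeal (MonoidAlgebra.single ((T.equivFin.symm i : T) : Γ) 1)) hp
    refine ⟨y, fun γ => ?_, hyf⟩
    have hγ : γ ∈ Subgroup.closure (T : Set Γ) := hT ▸ Subgroup.mem_top γ
    have hle : Subgroup.closure (T : Set Γ) ≤ (unitBall p).comap (char y / char x₀) := by
      rw [Subgroup.closure_le]
      intro t ht
      have h1 := hy (T.equivFin ⟨t, ht⟩)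
      simp only [Equiv.symm_apply_apply] at h1
      rw [← hchar, ← hchar] at h1
      change ‖((char y t / char x₀ t : (PadicAlgCl p)ˣ) : PadicAlgCl p) - 1‖ < 1 / p
      have h2 : ((char y t / char x₀ t : (PadicAlgCl p)ˣ) : PadicAlgCl p) - 1 =
          (char y t - char x₀ t) / char x₀ t := by
        rw [Units.val_div_eq_div_val, sub_div, div_self (Units.ne_zero _)]
      rw [h2, norm_div, hx₀char, ContChar.norm_eq_one, div_one, ← hx₀char]
      exact h1
    exact hle hγ
  have hnear : ∀ y, near y → ∃ B ∈ (A ×ˢ A).powerset,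
      LiesOnTorsionCoset G (char y) (quotientSaturation B) := by
    intro y hy
    obtain ⟨χ, hχ⟩ := exists_contChar_extension (char y) fun γ => by
      have h := norm_eq_one_of_norm_sub_one_lt (hy γ)
      rw [Units.val_div_eq_div_val, norm_div, hx₀char, ContChar.norm_eq_one, div_one] at h
      exact h
    have hχy : (χ.1 : ProfComp Γ →* (PadicAlgCl p)ˣ).comp (ProfComp.of Γ) = char y :=
      MonoidHom.ext hχ
    rw [← hχy]
    refine hcoset χ (hzS _ ?_)
    rw [ContChar.phi, hχy]
    exact hcharP y
  -- Since the near points are Zariski dense in the irreducible set `S'`, so are those belonging to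
  -- one of the finitely many subgroups.
  obtain ⟨B, hB⟩ : ∃ B : Finset (Γ × Γ), ∀ f : R, f ≠ 0 → ∃ y, near y ∧
      LiesOnTorsionCoset G (char y) (quotientSaturation B) ∧ y f ≠ 0 := by
    by_contra! h
    choose f hf0 hf using h
    obtain ⟨y, hy, hyf⟩ := hdense (∏ B ∈ (A ×ˢ A).powerset, f B)
      (Finset.prod_ne_zero_iff.2 fun B _ => hf0 B)
    obtain ⟨B, hBA, hB⟩ := hnear y hy
    refine hyf ?_
    rw [map_prod]
    exact Finset.prod_eq_zero hBA (hf B y hy hB)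
  set N := quotientSaturation B with hNdef
  have htf : IsMulTorsionFree (Γ ⧸ N) :=
    isMulTorsionFree_quotient (Subgroup.mem_saturation_of_pow_mem _)
  obtain ⟨y₀, hy₀, ⟨⟨M, hM, hy₀M⟩, hy₀Q⟩, -⟩ := hB 1 one_ne_zero
  -- On `N` all these points agree: their quotients are torsion and close to `1`.
  have hNP : ∀ γ ∈ N, MonoidAlgebra.single γ 1 - algebraMap (PadicAlgCl p) _
      (char y₀ γ : PadicAlgCl p) ∈ P.asIdeal := by
    intro γ hγ
    by_contra hne
    obtain ⟨y, hy, ⟨⟨M', hM', hyM'⟩, -⟩, hyf⟩ := hB (Ideal.Quotient.mk P.asIdeal _)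
      (mt Ideal.Quotient.eq_zero_iff_mem.1 hne)
    have h1 : char y γ / char y₀ γ ∈ unitBall p := by
      have := (unitBall p).div_mem (hy γ) (hy₀ γ)
      rwa [div_div_div_cancel_right] at this
    have h2 : char y γ / char y₀ γ = 1 := by
      refine eq_one_of_mem_unitBall h1 (isOfFinOrder_iff_pow_eq_one.2
        ⟨M * M', Nat.mul_pos hM hM', ?_⟩)
      rw [div_pow, pow_mul (char y₀ γ), hy₀M γ hγ, one_pow, mul_comm, pow_mul, hyM' γ hγ, one_pow,
        div_one]
    refine hyf ?_
    rw [map_sub, map_sub, ← hchar, div_eq_one.1 h2, sub_eq_zero]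
    exact (y.commutes _).symm
  obtain ⟨χ, hχ, hχN⟩ := exists_isOfFinOrder_extension N (char y₀) hM hy₀M
  have hJprime : (RingHom.ker (CharVar.restrict χ N)).IsPrime := RingHom.ker_isPrime _
  let J : CharVar (PadicAlgCl p) Γ := ⟨RingHom.ker (CharVar.restrict χ N), hJprime⟩
  have hJS : J ∈ S := by
    refine (hGS J).1 fun Q hQ => CharVar.mem_ker_restrict χ N Q fun γ₀ => ?_
    have h := hy₀Q Q hQ γ₀
    rw [← mul_zero ((χ γ₀ / char y₀ γ₀ : (PadicAlgCl p)ˣ) : PadicAlgCl p), ← h, Finset.mul_sum]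
    refine Finset.sum_congr rfl fun γ hγ => ?_
    have h1 := hχN _ (Finset.mem_filter.1 hγ).2
    rw [map_div, map_div, div_eq_div_iff_mul_eq_mul] at h1
    have h2 : χ γ = χ γ₀ / char y₀ γ₀ * char y₀ γ := by
      rw [div_mul_eq_mul_div, eq_div_iff_mul_eq', h1, mul_comm]
    rw [h2, Units.val_mul]
    ring
  have hJP : J = P := hPmin J hJS (CharVar.ker_restrict_le χ N P.asIdeal fun γ hγ => by
    rw [hχN γ hγ]
    exact hNP γ hγ)
  refine ⟨CharVar.ofQuotient (PadicAlgCl p) N, χ, ⟨N, htf, rfl⟩, hχ, ?_⟩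
  rw [hPz, ← hJP, CharVar.translate_image_ofQuotient]
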